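/- **Theorem 2 (Qubits with total magnetization symmetry).** *Setting.* Let $n\ge 2$, $d=2^n$, let $\mathcal P(n)=\{\mathbb I,X,Y,Z\}^{\otimes n}$, and let $|P|$ be the number of nontrivial tensor factors of $P\in\mathcal P(n)$. Let $M=\sum_i Z_i$, and let $\rho$ be an $n$-qubit density operator lying in a sector of fixed magnetization $m\in\mathbb R$, i.e. $M\rho=m\rho$. Put $S_1=\sum_i Z_i$ and $S_2=2\sum_{i<j}Z_iZ_j$. *Protocol.* Let $U_{(\pi,C)}=S_\pi C$, where $S_\pi$ permutes the qubits according to $\pi\in\mathrm{Sym}(n)$ and $C\in\mathrm{Cl}(1)^{\otimes n}$ is a tensor product of single-qubit Cliffords. The noise is an arbitrary completely positive, trace-preserving map $\mathcal E$ on $n$-qubit operators, independent of the unitary and of time. In each run one draws $g=(\pi,C)$ uniformly from $\mathrm{Sym}(n)\times\mathrm{Cl}(1)^{\otimes n}$ and obtains $b\in\{0,1\}^n$ with probability $\langle b|\mathcal E(U_g\rho U_g^\dagger)|b\rangle$. Put $\hat\rho_{g,b}=\mathcal M^{-1}(U_g^\dagger|b\rangle\langle b|U_g)$, where $\mathcal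 M(A)=\mathbb E_g\sum_b \langle b|U_gAU_g^\dagger|b\rangle\,U_g^\dagger|b\rangle\langle b|U_g$ is the noiseless measurement channel. Let $\hat\rho(T)$ be the mean of $\hat\rho_{g,b}$ over $T$ independent runs. With $\mathcal M_Z(A)=\sum_b\langle b|A|b\rangle|b\rangle\langle b|$ and $\Pi_k(A)=d^{-1}\sum_{|P|=k}\operatorname{tr}(PA)P$, let $$F=F_{Z,\{1,2\}}(\mathcal E)=\min_{k\in\{1,2\}}\frac{\operatorname{tr}(\mathcal E\mathcal M_Z\Pi_k)}{\operatorname{tr}(\mathcal M_Z\Pi_k)} .$$ *Claim.* There is an absolute constant $c>0$, and for every $B>0$ a constant $K>0$ depending only on $B$, such that the following holds for all $n\ge 2$, $\rho$, $m$, $\mathcal E$ as above with $0<|m|\le B$ and $m^2\ne n$. 1. The ideal values of the symmetries are $s_1=\operatorname{tr}(S_1\rho)=m$ and $s_2=\operatorname{tr}(S_2\rho)=m^2-n$. 2. The single-run estimators $\hat s_k=\operatorname{tr}(S_k\hat\rho_{g,b})$ of the noisy experiment satisfy $\mathbb V[\hat s_1/s_1]\le Kn$ and $\mathbb V[\hat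 s_2/s_2]\le K$. 3. If $F>0$, then for all $\epsilon,\delta\in(0,1)$ and every integer $T\ge K\,n\log(n/\delta)\,\epsilon^{-2}F^{-2}$, with probability at least $1-\delta$ the following holds simultaneously for all one- and two-local Pauli operators $P\in\mathcal P(n)$ ($k=|P|\in\{1,2\}$): the estimator $$\hat o_P^{\mathrm{EM}}(T)=\frac{\operatorname{tr}(P\hat\rho(T))}{\operatorname{tr}(S_k\hat\rho(T))/s_k}$$ is well defined (nonzero denominator) and $|\hat o_P^{\mathrm{EM}}(T)-\operatorname{tr}(P\rho)|\le\epsilon+c\,\epsilon^2$. -/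

import Mathlib

open scoped Matrix ComplexOrder

namespace SymShadow

noncomputable section

/-- Computational basis labels `b ∈ {0,1}^n`. -/
abbrev Bits (n : ℕ) : Type := Fin n → Fin 2

/-- Operators on `(ℂ²)^{⊗ n}`, written as matrices in the computational basis. -/
abbrev Op (n : ℕ) : Type := Matrix (Bits n) (Bits n) ℂ

/-- Superoperators: linear maps on the space of operators. -/
abbrev SuperOp (n : ℕ) : Type := Op n →ₗ[ℂ] Op n

/-- Single-qubit operators. -/
abbrev Mat2 : Type := Matrix (Fin 2) (Fin 2) ℂ

/-! ### Pauli operators -/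

/-- The single-qubit matrices `I, X, Y, Z`, indexed by `0, 1, 2, 3`. -/
def pauli : Fin 4 → Mat2 :=
  ![1, !![0, 1; 1, 0], !![0, -Complex.I; Complex.I, 0], !![1, 0; 0, -1]]

/-- The tensor product `A_0 ⊗ ⋯ ⊗ A_{n-1}` of single-qubit matrices. -/
def tensor {n : ℕ} (A : Fin n → Mat2) : Op n :=
  Matrix.of fun b b' => ∏ i, A i (b i) (b' i)

/-- The Pauli operator `⊗_i σ_{p i} ∈ {I, X, Y, Z}^{⊗ n}`. -/
def pauliString {n : ℕ} (p : Fin n → Fin 4) : Op n := tensor fun i => pauli (p i)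

/-- The weight (locality) of a Pauli operator: its number of nontrivial tensor factors. -/
def weight {n : ℕ} (p : Fin n → Fin 4) : ℕ := (Finset.univ.filter fun i => p i ≠ 0).card

/-- `Z_i`: the Pauli `Z` on qubit `i`, identity elsewhere. -/
def pauliZ {n : ℕ} (i : Fin n) : Op n := pauliString (Pi.single i 3)

/-! ### The single-qubit Clifford group -/

/-- The signed nontrivial single-qubit Pauli matrices `±X, ±Y, ±Z`. -/
def signedPauli : Set (Mat2) :=
  {A | ∃ a : Fin 4, a ≠ 0 ∧ (A = pauli a ∨ A = -pauli a)}

/-- The single-qubit Clifford group `Cl(1)`: the unitaries whose conjugation action permutes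
`{±X, ±Y, ±Z}`, with the physically irrelevant global phase fixed by `det U = 1`.
(Each of the 24 Clifford unitaries modulo phase is thereby represented by exactly the two
elements `U` and `-U`, so that the uniform distribution is the usual one.) -/
def Cl1 : Subgroup (Matrix.unitaryGroup (Fin 2) ℂ) where
  carrier := {U | (U : Mat2).det = 1 ∧
    ∀ A : Mat2, A ∈ signedPauli ↔
      (U : Mat2) * A * (U : Mat2)ᴴ ∈ signedPauli}
  one_mem' := by simp
  mul_mem' := by
    rintro U V ⟨hU, hU'⟩ ⟨hV, hV'⟩
    refine ⟨by simp [hU, hV], fun A => ?_⟩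
    rw [hV' A, hU']
    simp [Matrix.mul_assoc, Matrix.conjTranspose_mul]
  inv_mem' := by
    rintro U ⟨hU, hU'⟩
    have h2 : (U : Mat2) * (U : Mat2)ᴴ = 1 :=
      Matrix.mem_unitaryGroup_iff.mp U.2
    have hc : ((U⁻¹ : Matrix.unitaryGroup (Fin 2) ℂ) : Mat2)
        = (U : Mat2)ᴴ := rfl
    refine ⟨by rw [hc, Matrix.det_conjTranspose, hU, star_one], fun A => ?_⟩
    rw [hc, Matrix.conjTranspose_conjTranspose, hU' (_ * A * _)]
    have : (U : Mat2) * ((U : Mat2)ᴴ * A *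
        (U : Mat2)) * (U : Mat2)ᴴ = A := by
      calc _ = ((U : Mat2) * (U : Mat2)ᴴ) * A *
            ((U : Mat2) * (U : Mat2)ᴴ) := by
            simp only [Matrix.mul_assoc]
        _ = A := by rw [h2]; simp
    rw [this]

/-- A matrix commuting with `X` and `Z` is scalar. -/
theorem scalar_of_commute (A : Mat2)
    (hX : A * pauli 1 = pauli 1 * A) (hZ : A * pauli 3 = pauli 3 * A) :
    A = A 0 0 • (1 : Mat2) := by
  have x00 := congrFun (congrFun hX 0) 1
  have z01 := congrFun (congrFun hZ 0) 1
  have z10 := congrFun (congrFun hZ 1) 0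
  simp [pauli, Matrix.mul_apply, Fin.sum_univ_two] at x00 z01 z10
  have h01 : A 0 1 = 0 := by linear_combination (-1 / 2 : ℂ) * z01
  have h10 : A 1 0 = 0 := by linear_combination (1 / 2 : ℂ) * z10
  ext i j
  fin_cases i <;> fin_cases j <;> simp [h01, h10, ← x00]

theorem signedPauli_finite : signedPauli.Finite := by
  have : signedPauli ⊆ Set.range pauli ∪ Set.range (fun a => -pauli a) := by
    rintro A ⟨a, -, h | h⟩
    · exact Or.inl ⟨a, h.symm⟩
    · exact Or.inr ⟨a, h.symm⟩
  exact ((Set.finite_range _).union (Set.finite_range _)).subset this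

theorem pauli_mem_signedPauli {a : Fin 4} (h : a ≠ 0) : pauli a ∈ signedPauli :=
  ⟨a, h, Or.inl rfl⟩

instance : Finite Cl1 := by
  let mat : Cl1 → Mat2 := fun U => ((U : Matrix.unitaryGroup (Fin 2) ℂ) : Mat2)
  let f : Cl1 → Mat2 × Mat2 := fun U => (mat U * pauli 1 * (mat U)ᴴ, mat U * pauli 3 * (mat U)ᴴ)
  have hmat : Function.Injective mat := fun U V h => Subtype.ext (Subtype.ext h)
  have hS : (signedPauli ×ˢ signedPauli).Finite := signedPauli_finite.prod signedPauli_finite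
  have key : (f ⁻¹' (signedPauli ×ˢ signedPauli)).Finite := by
    refine Set.Finite.preimage' hS fun y _ => ?_
    by_cases hne : (f ⁻¹' {y}).Nonempty
    · obtain ⟨V, hV⟩ := hne
      have hsub : f ⁻¹' {y} ⊆ mat ⁻¹' {mat V, -mat V} := by
        intro U hU
        have hUV : f U = f V := by
          rw [Set.mem_preimage, Set.mem_singleton_iff] at hU hV
          rw [hU, hV]
        have hU1 : (mat U)ᴴ * mat U = 1 := Matrix.mem_unitaryGroup_iff'.mp U.1.2
        have hV1 : (mat V)ᴴ * mat V = 1 := Matrix.mem_unitaryGroup_iff'.mp V.1.2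
        have hV2 : mat V * (mat V)ᴴ = 1 := Matrix.mem_unitaryGroup_iff.mp V.1.2
        have comm : ∀ P : Mat2, mat U * P * (mat U)ᴴ = mat V * P * (mat V)ᴴ →
            ((mat V)ᴴ * mat U) * P = P * ((mat V)ᴴ * mat U) := by
          intro P hP
          calc ((mat V)ᴴ * mat U) * P
              = (mat V)ᴴ * (mat U * P * ((mat U)ᴴ * mat U)) := by
                rw [hU1]; simp [Matrix.mul_assoc]
            _ = (mat V)ᴴ * (mat U * P * (mat U)ᴴ) * mat U := by simp only [Matrix.mul_assoc]
            _ = (mat V)ᴴ * (mat V * P * (mat V)ᴴ) * mat U := by rw [hP]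
            _ = ((mat V)ᴴ * mat V) * P * ((mat V)ᴴ * mat U) := by simp only [Matrix.mul_assoc]
            _ = P * ((mat V)ᴴ * mat U) := by rw [hV1, Matrix.one_mul]
        have hsc := scalar_of_commute _ (comm _ (congrArg Prod.fst hUV))
          (comm _ (congrArg Prod.snd hUV))
        set c := ((mat V)ᴴ * mat U) 0 0 with hc
        have hUc : mat U = c • mat V := by
          calc mat U = mat V * ((mat V)ᴴ * mat U) := by
                rw [← Matrix.mul_assoc, hV2, Matrix.one_mul]
            _ = c • mat V := by rw [hsc]; simp
        have hdU : (mat U).det = 1 := U.2.1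
        have hdV : (mat V).det = 1 := V.2.1
        have hc2 : c ^ 2 = 1 := by
          rw [hUc, Matrix.det_smul, hdV] at hdU
          simpa using hdU
        rcases eq_or_eq_neg_of_sq_eq_sq c 1 (by rw [hc2, one_pow]) with h | h
        · left; rw [hUc, h, one_smul]
        · right; rw [Set.mem_singleton_iff, hUc, h, neg_one_smul]
      exact (Set.Finite.preimage hmat.injOn (by simp)).subset hsub
    · rw [Set.not_nonempty_iff_eq_empty.mp hne]; exact Set.finite_empty
  have huniv : f ⁻¹' (signedPauli ×ˢ signedPauli) = Set.univ := by
    ext U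
    simp only [Set.mem_preimage, Set.mem_univ, iff_true]
    exact ⟨(U.2.2 _).mp (pauli_mem_signedPauli (by decide)),
      (U.2.2 _).mp (pauli_mem_signedPauli (by decide))⟩
  rw [huniv] at key
  exact Set.finite_univ_iff.mp key

instance : Fintype Cl1 := Fintype.ofFinite _

/-! ### The subsystem-symmetrized local Clifford group -/

/-- The group `Sym(n) × Cl(1)^{⊗ n}` of random measurement unitaries. -/
abbrev SymCl (n : ℕ) : Type := Equiv.Perm (Fin n) × (Fin n → Cl1)

/-- The qubit permutation `S_π |b_0 ⋯ b_{n-1}⟩ = |b_{π⁻¹(0)} ⋯ b_{π⁻¹(n-1)}⟩`. -/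
def permOp {n : ℕ} (π : Equiv.Perm (Fin n)) : Op n :=
  Matrix.of fun b' b => if b' = fun i => b (π⁻¹ i) then 1 else 0

/-- The unitary `U_{(π, C)} = S_π (C_0 ⊗ ⋯ ⊗ C_{n-1})`. -/
def groupUnitary {n : ℕ} (g : SymCl n) : Op n :=
  permOp g.1 *
    tensor fun i => ((g.2 i : Matrix.unitaryGroup (Fin 2) ℂ) : Mat2)

/-- The conjugation superoperator `A ↦ V A V†`. -/
def conjBy {n : ℕ} (V : Op n) : SuperOp n where
  toFun A := V * A * Vᴴ
  map_add' A B := by rw [Matrix.mul_add, Matrix.add_mul]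
  map_smul' c A := by simp

/-! ### Measurement channels, classical shadows and the noise fidelity -/

/-- The computational-basis projector `|b⟩⟨b|`. -/
def basisProj {n : ℕ} (b : Bits n) : Op n := Matrix.single b b 1

/-- The computational-basis measurement channel `M_Z(A) = ∑_b ⟨b|A|b⟩ |b⟩⟨b|`. -/
def measZ (n : ℕ) : SuperOp n where
  toFun A := ∑ b, A b b • basisProj b
  map_add' A B := by simp [add_smul, Finset.sum_add_distrib]
  map_smul' c A := by simp [Finset.smul_sum, smul_smul]

/-- The noiseless shadow channel `M = 𝔼_g U_g† ∘ M_Z ∘ U_g`. -/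
def shadowChannel (n : ℕ) : SuperOp n :=
  (Fintype.card (SymCl n) : ℂ)⁻¹ •
    ∑ g : SymCl n, conjBy (groupUnitary g)ᴴ ∘ₗ measZ n ∘ₗ conjBy (groupUnitary g)

/-- The classical shadow `M⁻¹(U_g† |b⟩⟨b| U_g)` of a measurement record `(g, b)`. -/
def shadow {n : ℕ} (x : SymCl n × Bits n) : Op n :=
  Ring.inverse (M₀ := Module.End ℂ (Op n)) (shadowChannel n)
    (conjBy (groupUnitary x.1)ᴴ (basisProj x.2))

/-- The projector `Π_k = 2^{-n} ∑_{|P| = k} |P⟩⟩⟨⟨P|` onto the span of weight-`k` Paulis. -/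
def irrepProj (n k : ℕ) : SuperOp n where
  toFun A := ((2 : ℂ) ^ n)⁻¹ • ∑ p : Fin n → Fin 4 with weight p = k,
    ((pauliString p)ᴴ * A).trace • pauliString p
  map_add' A B := by
    simp [Matrix.mul_add, add_smul, Finset.sum_add_distrib]
  map_smul' c A := by
    simp only [Matrix.mul_smul, Matrix.trace_smul, smul_eq_mul, mul_smul, RingHom.id_apply]
    rw [← Finset.smul_sum, smul_comm]

/-- The noise fidelity on a single weight sector, `tr(𝓔 M_Z Π_k) / tr(M_Z Π_k)`
(a real number when `𝓔` preserves Hermiticity). -/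
def fidelityAt {n : ℕ} (E : SuperOp n) (k : ℕ) : ℝ :=
  (LinearMap.trace ℂ (Op n) (E ∘ₗ measZ n ∘ₗ irrepProj n k) /
    LinearMap.trace ℂ (Op n) (measZ n ∘ₗ irrepProj n k)).re

/-- `F_{Z,{1,2}}(𝓔) = min_{k ∈ {1,2}} tr(𝓔 M_Z Π_k) / tr(M_Z Π_k)`. -/
def fidelity {n : ℕ} (E : SuperOp n) : ℝ := min (fidelityAt E 1) (fidelityAt E 2)

/-- Application of `id_r ⊗ 𝓔` to an operator on `ℂ^r ⊗ (ℂ²)^{⊗ n}`. -/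
def ampliate {n : ℕ} (E : SuperOp n) (r : ℕ)
    (X : Matrix (Fin r × Bits n) (Fin r × Bits n) ℂ) :
    Matrix (Fin r × Bits n) (Fin r × Bits n) ℂ :=
  Matrix.of fun x y => E (Matrix.of fun b b' => X (x.1, b) (y.1, b')) x.2 y.2

/-- Completely positive, trace-preserving maps. -/
structure IsCPTP {n : ℕ} (E : SuperOp n) : Prop where
  completelyPositive : ∀ (r : ℕ) (X : Matrix (Fin r × Bits n) (Fin r × Bits n) ℂ),
    X.PosSemidef → (ampliate E r X).PosSemidef
  tracePreserving : ∀ A : Op n, (E A).trace = A.trace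

/-- Density operators. -/
structure IsState {n : ℕ} (ρ : Op n) : Prop where
  posSemidef : ρ.PosSemidef
  trace_eq_one : ρ.trace = 1

/-! ### Symmetries -/

/-- The total magnetization `∑_i Z_i`. -/
def magnetization (n : ℕ) : Op n := ∑ i, pauliZ i

/-- `S₁ = ∑_i Z_i`, and `S₂ = 2 ∑_{i<j} Z_i Z_j` (the index is the Pauli weight). -/
def symOp (n : ℕ) : ℕ → Op n
  | 1 => ∑ i, pauliZ i
  | 2 => (2 : ℂ) • ∑ i, ∑ j with i < j, pauliZ i * pauliZ j
  | _ => 0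

/-- The known ideal values `s₁ = m` and `s₂ = m² - n` of the two symmetries. -/
def symVal (n : ℕ) (m : ℝ) : ℕ → ℝ
  | 1 => m
  | 2 => m ^ 2 - n
  | _ => 0

/-! ### Statistics of the noisy experiment -/

/-- The probability of the record `(g, b)` in one run of the noisy experiment: `g` is uniform,
and then `b` occurs with probability `⟨b| 𝓔(U_g ρ U_g†) |b⟩`. -/
def shotProb {n : ℕ} (E : SuperOp n) (ρ : Op n) (x : SymCl n × Bits n) : ℝ :=
  (Fintype.card (SymCl n) : ℝ)⁻¹ * (E (conjBy (groupUnitary x.1) ρ) x.2 x.2).re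

/-- Single-run expectation of a random variable. -/
def shotMean {n : ℕ} (E : SuperOp n) (ρ : Op n) (f : SymCl n × Bits n → ℝ) : ℝ :=
  ∑ x, shotProb E ρ x * f x

/-- Single-run variance of a random variable. -/
def shotVar {n : ℕ} (E : SuperOp n) (ρ : Op n) (f : SymCl n × Bits n → ℝ) : ℝ :=
  shotMean E ρ fun x => (f x - shotMean E ρ f) ^ 2

open scoped Classical in
/-- Probability of an event over `T` independent runs of the noisy experiment. -/
def prob {n : ℕ} (E : SuperOp n) (ρ : Op n) {T : ℕ}
    (event : Set (Fin T → SymCl n × Bits n)) : ℝ :=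
  ∑ ω, if ω ∈ event then ∏ l, shotProb E ρ (ω l) else 0

/-- The single-run estimate `tr(O ρ̂)` of a Hermitian observable `O`. -/
def shotEst {n : ℕ} (O : Op n) (x : SymCl n × Bits n) : ℝ := (O * shadow x).trace.re

/-- The `T`-run estimate `tr(O ρ̂(T))`, with `ρ̂(T)` the mean of the `T` classical shadows. -/
def meanEst {n : ℕ} (O : Op n) {T : ℕ} (ω : Fin T → SymCl n × Bits n) : ℝ :=
  (T : ℝ)⁻¹ * ∑ l, shotEst O (ω l)

/-- The symmetry-adjusted estimate `tr(O ρ̂(T)) / (tr(S_k ρ̂(T)) / s_k)` of an observable `O`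
in the weight-`k` sector. -/
def mitigatedEst {n : ℕ} (m : ℝ) (O : Op n) (k : ℕ) {T : ℕ}
    (ω : Fin T → SymCl n × Bits n) : ℝ :=
  meanEst O ω / (meanEst (symOp n k) ω / symVal n m k)

end

end SymShadow

namespace SymShadow

/-! ### Tensor products and Pauli strings -/

/-! The core is a twirling argument. Averaging over local Cliffords kills cross terms between
distinct Pauli strings (`twirlSum_eq_zero`) and makes a weight-k string diagonal with probability
3^{-k} (`prod_sum_diagInd`). Averaging over permutations makes all k-subsets of qubits equivalent
(`sum_perm_map`). So the measured, twirled noise acts on weight-k Paulis as the scalar 3^{-k} f_k,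
and f_k is the noise fidelity of the sector (`twirlSum_pauliString`, `fidelityAt_eq`). Without noise
f_k = 1, so inverting the channel multiplies weight k by 3^k, and the noisy estimate of P has mean
f_k tr(Pρ) (`shotMean_pauliString`). Since S_k is damped by the same f_k, the quotient cancels it.

For the variances, each record assigns values v_i in {0, 1, -1} to the qubits, and every Z-string is
estimated by a product of factors 3 v_i (`exists_localVal`). Squares of the symmetry estimates are
then bounded pointwise by symmetric sums of Z-string estimates of weight 2 and 4. Their means are
f_k times polynomials in m and n, because ρ lives on bit strings of magnetization m, and |f_k| ≤ 1
because the noise is CPTP. As m is an eigenvalue of the magnetization it is an integer, so |m| ≥ 1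
and |m² - n| ≥ 1, and the latter improves to n ≤ (2 + 2B²)|m² - n|.

Finally, a Bernstein bound with range and variance both at most `varConst B * n` controls the two
normalized symmetry estimates and the O(n²) Pauli estimates. A union bound and the deterministic
quotient estimate `abs_ratio_sub_le` conclude, with error ε and no quadratic term. -/

theorem tensor_apply {n : ℕ} (A : Fin n → Mat2) (b b' : Bits n) :
    tensor A b b' = ∏ i, A i (b i) (b' i) := rfl

theorem tensor_mul {n : ℕ} (A B : Fin n → Mat2) :
    tensor A * tensor B = tensor fun i => A i * B i := by
  ext b b'
  simp only [Matrix.mul_apply, tensor_apply, ← Finset.prod_mul_distrib]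
  rw [Finset.prod_univ_sum, Fintype.piFinset_univ]

theorem tensor_conjTranspose {n : ℕ} (A : Fin n → Mat2) :
    (tensor A)ᴴ = tensor fun i => (A i)ᴴ := by
  ext b b'
  simp [Matrix.conjTranspose_apply, tensor_apply]

theorem tensor_one {n : ℕ} : tensor (fun _ : Fin n => (1 : Mat2)) = 1 := by
  ext b b'
  rw [tensor_apply, Matrix.one_apply]
  split_ifs with h
  · subst h; simp
  · obtain ⟨i, hi⟩ := Function.ne_iff.mp h
    exact Finset.prod_eq_zero (Finset.mem_univ i) (Matrix.one_apply_ne hi)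

theorem tensor_smul {n : ℕ} (s : Fin n → ℂ) (A : Fin n → Mat2) :
    tensor (fun i => s i • A i) = (∏ i, s i) • tensor A := by
  ext b b'
  simp [tensor_apply, Finset.prod_mul_distrib]

theorem permOp_mul_apply {n : ℕ} (π : Equiv.Perm (Fin n)) (A : Op n) (b b' : Bits n) :
    (permOp π * A) b b' = A (fun i => b (π i)) b' := by
  rw [Matrix.mul_apply, Finset.sum_eq_single fun i => b (π i)]
  · simp [permOp]
  · intro c _ hc
    have : b ≠ fun i => c (π⁻¹ i) := by
      rintro rfl
      exact hc (by ext i; simp)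
    simp only [permOp, Matrix.of_apply, if_neg this, zero_mul]
  · simp

theorem permOp_conj_apply {n : ℕ} (π : Equiv.Perm (Fin n)) (A : Op n) (b b' : Bits n) :
    (permOp π * A * (permOp π)ᴴ) b b' = A (fun i => b (π i)) (fun i => b' (π i)) := by
  -- Two adjoints turn right multiplication by the adjoint into a second left multiplication.
  have h : permOp π * A * (permOp π)ᴴ = (permOp π * (permOp π * A)ᴴ)ᴴ := by
    rw [Matrix.conjTranspose_mul, Matrix.conjTranspose_conjTranspose]
  rw [h, Matrix.conjTranspose_apply, permOp_mul_apply, Matrix.conjTranspose_apply, star_star,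
    permOp_mul_apply]

theorem permOp_conj_tensor {n : ℕ} (π : Equiv.Perm (Fin n)) (A : Fin n → Mat2) :
    permOp π * tensor A * (permOp π)ᴴ = tensor fun j => A (π⁻¹ j) := by
  ext b b'
  rw [permOp_conj_apply, tensor_apply, tensor_apply]
  exact Fintype.prod_equiv π _ _ (by simp)

/-- The conjugate `C A C†` of a single-qubit operator by a Clifford. -/
noncomputable def cliffConj (C : Cl1) (A : Mat2) : Mat2 :=
  ((C : Matrix.unitaryGroup (Fin 2) ℂ) : Mat2) * A *
    ((C : Matrix.unitaryGroup (Fin 2) ℂ) : Mat2)ᴴ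

theorem conjBy_groupUnitary_tensor {n : ℕ} (g : SymCl n) (A : Fin n → Mat2) :
    conjBy (groupUnitary g) (tensor A) =
      tensor fun j => cliffConj (g.2 (g.1⁻¹ j)) (A (g.1⁻¹ j)) := by
  have : conjBy (groupUnitary g) (tensor A) = permOp g.1 *
      tensor (fun i => cliffConj (g.2 i) (A i)) * (permOp g.1)ᴴ := by
    change groupUnitary g * tensor A * (groupUnitary g)ᴴ = _
    rw [groupUnitary, Matrix.conjTranspose_mul, tensor_conjTranspose]
    simp only [cliffConj, ← tensor_mul, Matrix.mul_assoc]
  rw [this, permOp_conj_tensor]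

theorem groupUnitary_mem {n : ℕ} (g : SymCl n) : (groupUnitary g)ᴴ * groupUnitary g = 1 := by
  have hp : ∀ π : Equiv.Perm (Fin n), (permOp π)ᴴ * permOp π = (1 : Op n) := by
    intro π
    have h : permOp π * (1 : Op n) * (permOp π)ᴴ = 1 := by
      rw [← tensor_one, permOp_conj_tensor]
    rw [Matrix.mul_one] at h
    exact mul_eq_one_comm.mp h
  rw [groupUnitary, Matrix.conjTranspose_mul, Matrix.mul_assoc, ← Matrix.mul_assoc _ (permOp g.1),
    hp, Matrix.one_mul, tensor_conjTranspose, tensor_mul, ← tensor_one]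
  congr 1
  funext i
  exact Matrix.mem_unitaryGroup_iff'.mp (g.2 i).1.2

theorem trace_conjBy {n : ℕ} (g : SymCl n) (A : Op n) :
    (conjBy (groupUnitary g) A).trace = A.trace := by
  change (groupUnitary g * A * (groupUnitary g)ᴴ).trace = _
  rw [Matrix.trace_mul_comm, ← Matrix.mul_assoc, groupUnitary_mem, Matrix.one_mul]

theorem pauli_conjTranspose (a : Fin 4) : (pauli a)ᴴ = pauli a := by
  fin_cases a <;> ext i j <;> fin_cases i <;> fin_cases j <;> simp [pauli]

theorem pauli_mul_self (a : Fin 4) : pauli a * pauli a = 1 := by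
  fin_cases a <;> ext i j <;> fin_cases i <;> fin_cases j <;>
    simp [pauli, Matrix.mul_apply, Fin.sum_univ_two]

theorem pauliString_conjTranspose {n : ℕ} (p : Fin n → Fin 4) :
    (pauliString p)ᴴ = pauliString p := by
  simp [pauliString, tensor_conjTranspose, pauli_conjTranspose]

theorem pauliString_mul_self {n : ℕ} (p : Fin n → Fin 4) :
    pauliString p * pauliString p = 1 := by
  simp [pauliString, tensor_mul, pauli_mul_self, tensor_one]

/-- The sum of σ_a ⊗ σ_a is twice the swap operator; its tensor power yields the Pauli expansion of
an arbitrary operator. -/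
theorem pauli_completeness (b c b' c' : Fin 2) :
    ∑ a, pauli a c c' * pauli a b b' = if b = c' ∧ b' = c then 2 else 0 := by
  fin_cases b <;> fin_cases c <;> fin_cases b' <;> fin_cases c' <;>
    simp [pauli, Fin.sum_univ_four] <;> norm_num

theorem pauliString_completeness {n : ℕ} (b c b' c' : Bits n) :
    ∑ p : Fin n → Fin 4, pauliString p c c' * pauliString p b b' =
      if b = c' ∧ b' = c then (2 : ℂ) ^ n else 0 := by
  simp only [pauliString, tensor_apply, ← Finset.prod_mul_distrib]
  have h := Finset.prod_univ_sum (fun _ : Fin n => (Finset.univ : Finset (Fin 4)))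
    (fun i a => pauli a (c i) (c' i) * pauli a (b i) (b' i))
  rw [Fintype.piFinset_univ] at h
  rw [← h]
  simp only [pauli_completeness]
  split_ifs with h
  · obtain ⟨rfl, rfl⟩ := h
    simp
  · rw [not_and_or] at h
    rcases h with h | h <;> obtain ⟨i, hi⟩ := Function.ne_iff.mp h <;>
      exact Finset.prod_eq_zero (Finset.mem_univ i) (by simp [hi])

theorem pauliString_expansion {n : ℕ} (B : Op n) :
    B = ((2 : ℂ) ^ n)⁻¹ • ∑ p : Fin n → Fin 4, (pauliString p * B).trace • pauliString p := by
  ext b b'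
  simp only [Matrix.smul_apply, Matrix.sum_apply, Matrix.trace, Matrix.diag_apply,
    Matrix.mul_apply, smul_eq_mul, Finset.sum_mul]
  have : ∑ p : Fin n → Fin 4, ∑ c, ∑ c', pauliString p c c' * B c' c * pauliString p b b' =
      (2 : ℂ) ^ n * B b b' := by
    rw [Finset.sum_comm]
    have : ∀ c, ∑ p : Fin n → Fin 4, ∑ c', pauliString p c c' * B c' c * pauliString p b b' =
        ∑ c', B c' c * if b = c' ∧ b' = c then (2 : ℂ) ^ n else 0 := by
      intro c
      rw [Finset.sum_comm]
      refine Finset.sum_congr rfl fun c' _ => ?_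
      rw [← pauliString_completeness, Finset.mul_sum]
      exact Finset.sum_congr rfl fun p _ => by ring
    simp only [this, ite_and]
    simp [mul_comm]
  rw [this, inv_mul_cancel_left₀ (by positivity)]

/-! ### The single-qubit Clifford group -/

theorem cliffConj_mul (C D : Cl1) (A : Mat2) :
    cliffConj (C * D) A = cliffConj C (cliffConj D A) := by
  simp [cliffConj, Matrix.mul_assoc, Matrix.conjTranspose_mul]

theorem cliffConj_one (C : Cl1) : cliffConj C 1 = 1 := by
  rw [cliffConj, Matrix.mul_one]
  exact Matrix.mem_unitaryGroup_iff.mp C.1.2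

theorem cliffConj_smul (C : Cl1) (s : ℂ) (A : Mat2) :
    cliffConj C (s • A) = s • cliffConj C A := by
  simp [cliffConj]

theorem cliffConj_neg (C : Cl1) (A : Mat2) : cliffConj C (-A) = -cliffConj C A := by
  simp [cliffConj]

theorem cliffConj_injective (C : Cl1) : Function.Injective (cliffConj C) := by
  intro A B h
  have := congrArg (cliffConj C⁻¹) h
  rw [← cliffConj_mul, ← cliffConj_mul, inv_mul_cancel] at this
  simpa [cliffConj] using this

theorem cliffConj_pauli_mem (C : Cl1) {a : Fin 4} (ha : a ≠ 0) :
    cliffConj C (pauli a) ∈ signedPauli :=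
  (C.2.2 _).mp (pauli_mem_signedPauli ha)

theorem neg_mem_signedPauli {A : Mat2} (h : A ∈ signedPauli) : -A ∈ signedPauli := by
  obtain ⟨a, ha, rfl | rfl⟩ := h
  · exact ⟨a, ha, Or.inr rfl⟩
  · exact ⟨a, ha, Or.inl (neg_neg _)⟩

/-- A special unitary such that it and its adjoint preserve the signed Paulis is a Clifford. -/
theorem exists_clifford (V : Mat2) (hV : V * Vᴴ = 1) (hdet : V.det = 1)
    (h₁ : ∀ a, a ≠ 0 → V * pauli a * Vᴴ ∈ signedPauli)
    (h₂ : ∀ a, a ≠ 0 → Vᴴ * pauli a * V ∈ signedPauli) :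
    ∃ C : Cl1, ∀ A, cliffConj C A = V * A * Vᴴ := by
  have hV' : Vᴴ * V = 1 := mul_eq_one_comm.mp hV
  refine ⟨⟨⟨V, Matrix.mem_unitaryGroup_iff.mpr hV⟩, hdet, fun A => ⟨?_, fun h => ?_⟩⟩,
    fun A => rfl⟩
  · rintro ⟨a, ha, rfl | rfl⟩
    · exact h₁ a ha
    · simpa using neg_mem_signedPauli (h₁ a ha)
  · change V * A * Vᴴ ∈ signedPauli at h
    have hA : A = Vᴴ * (V * A * Vᴴ) * V := by
      calc A = (Vᴴ * V) * A * (Vᴴ * V) := by rw [hV']; simp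
        _ = _ := by simp only [Matrix.mul_assoc]
    rw [hA]
    obtain ⟨a, ha, h | h⟩ := h
    · rw [h]; exact h₂ a ha
    · rw [h]; simpa using neg_mem_signedPauli (h₂ a ha)

/-- The sign `σ_c σ_a σ_c = ± σ_a`. -/
def pauliSign (c a : Fin 4) : ℂ := if a = 0 ∨ c = 0 ∨ a = c then 1 else -1

theorem pauli_conj_pauli (c a : Fin 4) :
    pauli c * pauli a * pauli c = pauliSign c a • pauli a := by
  fin_cases c <;> fin_cases a <;> ext i j <;> fin_cases i <;> fin_cases j <;>
    simp [pauli, pauliSign, Matrix.mul_apply, Fin.sum_univ_two]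

theorem exists_clifford_pauli (c : Fin 4) :
    ∃ C : Cl1, ∀ a, cliffConj C (pauli a) = pauliSign c a • pauli a := by
  by_cases hc : c = 0
  · refine ⟨1, fun a => ?_⟩
    simp [cliffConj, pauliSign, hc]
  -- The phase i gives determinant one, since a nontrivial Pauli has determinant -1; it cancels
  -- under conjugation.
  have hI : ∀ A : Mat2, (Complex.I • pauli c) * A * (Complex.I • pauli c)ᴴ =
      pauli c * A * pauli c := by
    intro A
    rw [Matrix.conjTranspose_smul, pauli_conjTranspose]
    simp [smul_smul]
  have hI' : ∀ A : Mat2, (Complex.I • pauli c)ᴴ * A * (Complex.I • pauli c) =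
      pauli c * A * pauli c := by
    intro A
    rw [Matrix.conjTranspose_smul, pauli_conjTranspose]
    simp [smul_smul]
  have hmem : ∀ a, a ≠ 0 → pauli c * pauli a * pauli c ∈ signedPauli := by
    intro a ha
    rw [pauli_conj_pauli, pauliSign]
    split_ifs
    · simpa using pauli_mem_signedPauli ha
    · simpa using neg_mem_signedPauli (pauli_mem_signedPauli ha)
  obtain ⟨C, hC⟩ := exists_clifford (Complex.I • pauli c) (by
      have := hI 1
      rwa [Matrix.mul_one, Matrix.mul_one, pauli_mul_self] at this) (by
      rw [Matrix.det_smul, Fintype.card_fin, Complex.I_sq]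
      revert hc
      fin_cases c <;> simp [pauli, Matrix.det_fin_two])
    (fun a ha => by rw [hI]; exact hmem a ha) (fun a ha => by rw [hI']; exact hmem a ha)
  exact ⟨C, fun a => by rw [hC, hI, pauli_conj_pauli]⟩

/-- Two distinct Paulis are separated by some third one that commutes with exactly one of them; this
is what makes cross terms vanish in the twirl. -/
theorem exists_pauliSign_ne {a b : Fin 4} (h : a ≠ b) :
    ∃ c, pauliSign c a * pauliSign c b = -1 := by
  have other : ∀ d : Fin 4, ∃ c : Fin 4, c ≠ 0 ∧ d ≠ c := by decide
  by_cases ha : a = 0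
  · obtain ⟨c, hc0, hc⟩ := other b
    exact ⟨c, by simp [pauliSign, ha, hc0, hc, ha ▸ h.symm]⟩
  by_cases hb : b = 0
  · obtain ⟨c, hc0, hc⟩ := other a
    exact ⟨c, by simp [pauliSign, hb, hc0, hc, ha]⟩
  · exact ⟨a, by simp [pauliSign, ha, hb, h.symm]⟩

/-- The order-three Clifford `(1 - i(X + Y + Z)) / 2`. -/
noncomputable def cycleMat : Mat2 :=
  (1 / 2 : ℂ) • !![1 - Complex.I, -1 - Complex.I; 1 - Complex.I, 1 + Complex.I]

theorem exists_clifford_cycle : ∃ C : Cl1, cliffConj C (pauli 1) = pauli 2 ∧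
    cliffConj C (pauli 2) = pauli 3 ∧ cliffConj C (pauli 3) = pauli 1 := by
  have hT : cycleMatᴴ = (1 / 2 : ℂ) •
      !![1 + Complex.I, 1 + Complex.I; -1 + Complex.I, 1 - Complex.I] := by
    ext i j
    fin_cases i <;> fin_cases j <;> simp [cycleMat, Matrix.conjTranspose_apply] <;> ring
  have hU : cycleMat * cycleMatᴴ = 1 := by
    rw [hT]
    ext i j
    fin_cases i <;> fin_cases j <;> simp [cycleMat, Matrix.mul_apply, Fin.sum_univ_two] <;>
      ring_nf <;> simp <;> norm_num
  have h1 : cycleMat * pauli 1 = pauli 2 * cycleMat := by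
    ext i j
    fin_cases i <;> fin_cases j <;>
      simp [cycleMat, pauli, Matrix.mul_apply, Fin.sum_univ_two] <;> ring_nf <;> simp <;> ring
  have h2 : cycleMat * pauli 2 = pauli 3 * cycleMat := by
    ext i j
    fin_cases i <;> fin_cases j <;>
      simp [cycleMat, pauli, Matrix.mul_apply, Fin.sum_univ_two] <;> ring_nf <;> simp <;> ring
  have h3 : cycleMat * pauli 3 = pauli 1 * cycleMat := by
    ext i j
    fin_cases i <;> fin_cases j <;>
      simp [cycleMat, pauli, Matrix.mul_apply, Fin.sum_univ_two] <;> ring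
  have hU' : cycleMatᴴ * cycleMat = 1 := mul_eq_one_comm.mp hU
  have conj : ∀ {A B : Mat2}, cycleMat * A = B * cycleMat → cycleMat * A * cycleMatᴴ = B := by
    intro A B h
    rw [h, Matrix.mul_assoc, hU, Matrix.mul_one]
  have conj' : ∀ {A B : Mat2}, cycleMat * A = B * cycleMat → cycleMatᴴ * B * cycleMat = A := by
    intro A B h
    rw [Matrix.mul_assoc, ← h, ← Matrix.mul_assoc, hU', Matrix.one_mul]
  obtain ⟨C, hC⟩ := exists_clifford cycleMat hU (by
      rw [cycleMat, Matrix.det_smul]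
      simp [Matrix.det_fin_two]
      ring_nf
      simp
      norm_num)
    (fun a ha => by
      fin_cases a
      · exact absurd rfl ha
      · exact (conj h1) ▸ pauli_mem_signedPauli (a := 2) (by decide)
      · exact (conj h2) ▸ pauli_mem_signedPauli (a := 3) (by decide)
      · exact (conj h3) ▸ pauli_mem_signedPauli (a := 1) (by decide))
    (fun a ha => by
      fin_cases a
      · exact absurd rfl ha
      · exact (conj' h3) ▸ pauli_mem_signedPauli (a := 3) (by decide)
      · exact (conj' h1) ▸ pauli_mem_signedPauli (a := 1) (by decide)
      · exact (conj' h2) ▸ pauli_mem_signedPauli (a := 2) (by decide))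
  exact ⟨C, by rw [hC, conj h1], by rw [hC, conj h2], by rw [hC, conj h3]⟩

open scoped Classical in
/-- The indicator that `C` maps `σ_a` to `±σ_c`. -/
noncomputable def axisInd (c : Fin 4) (C : Cl1) (a : Fin 4) : ℂ :=
  if cliffConj C (pauli a) = pauli c ∨ cliffConj C (pauli a) = -pauli c then 1 else 0

theorem pauli_eq_signed_iff {a c : Fin 4} : (pauli a = pauli c ∨ pauli a = -pauli c) ↔ a = c := by
  constructor
  · rintro (h | h)
    all_goals
      have h00 := congrFun (congrFun h 0) 0
      have h01 := congrFun (congrFun h 0) 1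
      have h10 := congrFun (congrFun h 1) 0
      have h11 := congrFun (congrFun h 1) 1
      revert h00 h01 h10 h11
      fin_cases a <;> fin_cases c <;>
        simp [pauli, Complex.ext_iff] <;> norm_num
  · rintro rfl
    exact Or.inl rfl

theorem sum_axisInd_axes (C : Cl1) {a : Fin 4} (ha : a ≠ 0) :
    axisInd 1 C a + axisInd 2 C a + axisInd 3 C a = 1 := by
  obtain ⟨d, hd, h | h⟩ := cliffConj_pauli_mem C ha
  · simp only [axisInd, h, pauli_eq_signed_iff]
    revert hd
    fin_cases d <;> simp
  · have neg_iff : ∀ c : Fin 4, (-pauli d = pauli c ∨ -pauli d = -pauli c) ↔ d = c := by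
      intro c
      rw [neg_inj, neg_eq_iff_eq_neg, or_comm, pauli_eq_signed_iff]
    simp only [axisInd, h, neg_iff]
    revert hd
    fin_cases d <;> simp

/-- Left multiplication by V permutes the group and carries the event of landing on axis c to that
of landing on axis d. -/
theorem sum_axisInd_eq (V : Cl1) (a : Fin 4) {c d : Fin 4} (h : cliffConj V (pauli c) = pauli d) :
    ∑ C : Cl1, axisInd d C a = ∑ C : Cl1, axisInd c C a := by
  refine (Fintype.sum_equiv (Equiv.mulLeft V) _ _ fun C => ?_).symm
  simp only [axisInd, Equiv.coe_mulLeft, cliffConj_mul, ← h, ← cliffConj_neg,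
    (cliffConj_injective V).eq_iff]

/-- A nontrivial Pauli lands on exactly one of three axes, and the order-three Clifford makes the
axes equally frequent. -/
theorem sum_axisInd (a : Fin 4) (ha : a ≠ 0) :
    ∑ C : Cl1, axisInd 3 C a = (Fintype.card Cl1 : ℂ) / 3 := by
  obtain ⟨V, h1, h2, -⟩ := exists_clifford_cycle
  have e1 := sum_axisInd_eq V a h1
  have e2 := sum_axisInd_eq V a h2
  have e : ∑ C : Cl1, (axisInd 1 C a + axisInd 2 C a + axisInd 3 C a) = Fintype.card Cl1 := by
    simp [sum_axisInd_axes _ ha]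
  rw [Finset.sum_add_distrib, Finset.sum_add_distrib, ← e1, ← e2] at e
  linear_combination e / 3

/-! ### Twirling a noise channel over the measurement group -/

/-- The Pauli operator `∏_{i ∈ I} Z_i`. -/
noncomputable def zString {n : ℕ} (I : Finset (Fin n)) : Op n :=
  pauliString fun i => if i ∈ I then 3 else 0

/-- The set of qubits on which a Pauli operator acts nontrivially. -/
def pauliSupport {n : ℕ} (p : Fin n → Fin 4) : Finset (Fin n) :=
  Finset.univ.filter fun i => p i ≠ 0

/-- The overlap of the diagonals of `E(Z_I)` and `Z_I`. -/
noncomputable def zOverlap {n : ℕ} (E : SuperOp n) (I : Finset (Fin n)) : ℂ :=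
  ∑ b, E (zString I) b b * zString I b b

/-- The overlap of the diagonals of `E(U_g B U_g†)` and `U_g P U_g†`, summed over the group. -/
noncomputable def twirlSum {n : ℕ} (E : SuperOp n) (P B : Op n) : ℂ :=
  ∑ g : SymCl n, ∑ b, E (conjBy (groupUnitary g) B) b b * conjBy (groupUnitary g) P b b

/-- The normalized average of `tr(Z_I E(Z_I))` over the subsets `I` of size `k`. -/
noncomputable def sectorFidelity {n : ℕ} (E : SuperOp n) (k : ℕ) : ℂ :=
  (n.choose k : ℂ)⁻¹ * ((2 : ℂ) ^ n)⁻¹ *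
    ∑ I ∈ Finset.powersetCard k Finset.univ, zOverlap E I

/-- `SymCl` carries the direct-product group law, for which `groupUnitary` is not a homomorphism.
Right multiplication by a purely local element is nevertheless compatible: V acts first, on qubit i.
-/
theorem conjBy_mul_mulSingle {n : ℕ} (g : SymCl n) (i : Fin n) (V : Cl1) (s : ℂ)
    (p : Fin n → Fin 4) (h : cliffConj V (pauli (p i)) = s • pauli (p i)) :
    conjBy (groupUnitary (g * (1, Pi.mulSingle i V))) (pauliString p) =
      s • conjBy (groupUnitary g) (pauliString p) := by
  rw [pauliString, conjBy_groupUnitary_tensor, conjBy_groupUnitary_tensor]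
  -- The scalar is written as a product over qubits with one nontrivial factor, at the image of i,
  -- to match the tensor factors.
  have hs : s = ∏ j, if g.1⁻¹ j = i then s else 1 := by
    rw [Finset.prod_eq_single (g.1 i)] <;> simp +contextual [Equiv.symm_apply_eq]
  conv_rhs => rw [hs, ← tensor_smul]
  congr 1
  funext j
  simp only [Prod.fst_mul, Prod.snd_mul, mul_one, Pi.mul_apply]
  by_cases hj : g.1⁻¹ j = i
  · rw [if_pos hj, hj, Pi.mulSingle_eq_same, cliffConj_mul, h, cliffConj_smul]
  · rw [if_neg hj, Pi.mulSingle_eq_of_ne hj, mul_one, one_smul]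

/-- Reindexing the group by a Pauli at a site where p and q differ, chosen with opposite signs on
the two, negates the sum. -/
theorem twirlSum_eq_zero {n : ℕ} (E : SuperOp n) {p q : Fin n → Fin 4} (h : p ≠ q) :
    twirlSum E (pauliString p) (pauliString q) = 0 := by
  obtain ⟨i, hi⟩ := Function.ne_iff.mp h
  obtain ⟨c, hc⟩ := exists_pauliSign_ne hi
  obtain ⟨V, hV⟩ := exists_clifford_pauli c
  have key : twirlSum E (pauliString p) (pauliString q) =
      -twirlSum E (pauliString p) (pauliString q) := by
    simp only [twirlSum, ← Finset.sum_neg_distrib]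
    refine (Fintype.sum_equiv (Equiv.mulRight ((1, Pi.mulSingle i V) : SymCl n)) _ _
      fun g => ?_).symm
    rw [Equiv.coe_mulRight]
    refine Finset.sum_congr rfl fun b _ => ?_
    rw [conjBy_mul_mulSingle g i V _ p (hV _), conjBy_mul_mulSingle g i V _ q (hV _), map_smul,
      Matrix.smul_apply, Matrix.smul_apply, smul_eq_mul, smul_eq_mul]
    linear_combination (-(E (conjBy (groupUnitary g) (pauliString q)) b b *
      conjBy (groupUnitary g) (pauliString p) b b)) * hc
  exact self_eq_neg.mp key

/-- The indicator that `C` maps `σ_a` into the span of the diagonal Paulis. -/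
noncomputable def diagInd (C : Cl1) (a : Fin 4) : ℂ := if a = 0 then 1 else axisInd 3 C a

theorem diagInd_cases (C : Cl1) (a : Fin 4) :
    (diagInd C a = 1 ∧ ∃ s : ℂ, s * s = 1 ∧
      cliffConj C (pauli a) = s • pauli (if a ≠ 0 then 3 else 0)) ∨
    (diagInd C a = 0 ∧ ∀ b, cliffConj C (pauli a) b b = 0) := by
  by_cases ha : a = 0
  · refine Or.inl ⟨by simp [diagInd, ha], 1, by simp, ?_⟩
    simp [ha, pauli, cliffConj_one]
  · by_cases h : cliffConj C (pauli a) = pauli 3 ∨ cliffConj C (pauli a) = -pauli 3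
    · refine Or.inl ⟨by simp [diagInd, ha, axisInd, h], ?_⟩
      rcases h with h | h
      · exact ⟨1, by simp, by simp [h, ha]⟩
      · exact ⟨-1, by simp, by simp [h, ha]⟩
    · refine Or.inr ⟨by simp only [diagInd, if_neg ha, axisInd, if_neg h], fun b => ?_⟩
      obtain ⟨d, hd, hC | hC⟩ := cliffConj_pauli_mem C ha
      all_goals
        have hd3 : d ≠ 3 := by
          rintro rfl
          simp [hC] at h
        rw [hC]
        revert hd hd3
        fin_cases d <;> fin_cases b <;> simp [pauli]

theorem zString_map {n : ℕ} (π : Equiv.Perm (Fin n)) (p : Fin n → Fin 4) :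
    zString ((pauliSupport p).map π.toEmbedding) =
      tensor fun j => pauli (if p (π⁻¹ j) ≠ 0 then 3 else 0) := by
  simp only [zString, pauliString, Finset.mem_map_equiv, pauliSupport, Finset.mem_filter,
    Finset.mem_univ, true_and]
  rfl

/-- Only the diagonal of the rotated string is ever measured: either every factor goes to ±Z or I,
giving a signed Z-string on the permuted support, or some factor becomes off-diagonal. -/
theorem conjBy_pauliString_cases {n : ℕ} (g : SymCl n) (p : Fin n → Fin 4) :
    ((∏ i, diagInd (g.2 i) (p i)) = 1 ∧ ∃ s : ℂ, s * s = 1 ∧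
      conjBy (groupUnitary g) (pauliString p) =
        s • zString ((pauliSupport p).map g.1.toEmbedding)) ∨
    ((∏ i, diagInd (g.2 i) (p i)) = 0 ∧
      ∀ b, conjBy (groupUnitary g) (pauliString p) b b = 0) := by
  by_cases h : ∀ i, diagInd (g.2 i) (p i) = 1
  · refine Or.inl ⟨Finset.prod_eq_one fun i _ => h i, ?_⟩
    have hs : ∀ i, ∃ s : ℂ, s * s = 1 ∧
        cliffConj (g.2 i) (pauli (p i)) = s • pauli (if p i ≠ 0 then 3 else 0) := by
      intro i
      rcases diagInd_cases (g.2 i) (p i) with h' | h'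
      · exact h'.2
      · rw [h i] at h'
        exact absurd h'.1 one_ne_zero
    choose s hs1 hs2 using hs
    refine ⟨∏ j, s (g.1⁻¹ j), by simp [← Finset.prod_mul_distrib, hs1], ?_⟩
    rw [pauliString, conjBy_groupUnitary_tensor, zString_map, ← tensor_smul]
    simp only [hs2]
  · push Not at h
    obtain ⟨i, hi⟩ := h
    rcases diagInd_cases (g.2 i) (p i) with h' | h'
    · exact absurd h'.1 hi
    · refine Or.inr ⟨Finset.prod_eq_zero (Finset.mem_univ i) h'.1, fun b => ?_⟩
      rw [pauliString, conjBy_groupUnitary_tensor, tensor_apply]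
      refine Finset.prod_eq_zero (Finset.mem_univ (g.1 i)) ?_
      simpa using h'.2 _

/-- The sign appears in both factors of the overlap and squares to one. -/
theorem overlap_pauliString {n : ℕ} (E : SuperOp n) (g : SymCl n) (p : Fin n → Fin 4) :
    ∑ b, E (conjBy (groupUnitary g) (pauliString p)) b b *
        conjBy (groupUnitary g) (pauliString p) b b =
      (∏ i, diagInd (g.2 i) (p i)) * zOverlap E ((pauliSupport p).map g.1.toEmbedding) := by
  rcases conjBy_pauliString_cases g p with ⟨h1, s, hs, h⟩ | ⟨h1, h⟩
  · rw [h1, one_mul, h, zOverlap]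
    refine Finset.sum_congr rfl fun b _ => ?_
    rw [map_smul, Matrix.smul_apply, Matrix.smul_apply, smul_eq_mul, smul_eq_mul]
    linear_combination (E (zString ((pauliSupport p).map g.1.toEmbedding)) b b *
      zString ((pauliSupport p).map g.1.toEmbedding) b b) * hs
  · simp [h1, h]

theorem prod_sum_diagInd {n : ℕ} (p : Fin n → Fin 4) :
    ∑ C : Fin n → Cl1, ∏ i, diagInd (C i) (p i) =
      (Fintype.card Cl1 : ℂ) ^ n * ((3 : ℂ) ^ weight p)⁻¹ := by
  have h := Finset.prod_univ_sum (fun _ : Fin n => (Finset.univ : Finset Cl1))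
    (fun i C => diagInd C (p i))
  rw [Fintype.piFinset_univ] at h
  rw [← h]
  have hi : ∀ i, ∑ C : Cl1, diagInd C (p i) =
      (Fintype.card Cl1 : ℂ) * if p i ≠ 0 then 3⁻¹ else 1 := by
    intro i
    by_cases h0 : p i = 0
    · simp [diagInd, h0]
    · simp [diagInd, h0, sum_axisInd _ h0, div_eq_mul_inv]
  simp only [hi, Finset.prod_mul_distrib, Finset.prod_const, Finset.card_univ, Fintype.card_fin,
    Finset.prod_ite, one_pow, mul_one, inv_pow]
  rfl

theorem exists_perm_map {α : Type*} [Fintype α] [DecidableEq α] {I J : Finset α}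
    (h : I.card = J.card) : ∃ τ : Equiv.Perm α, I.map τ.toEmbedding = J := by
  let e : {x // x ∈ I} ≃ {x // x ∈ J} := Finset.equivOfCardEq h
  refine ⟨e.extendSubtype, Finset.eq_of_subset_of_card_le ?_ (by simp [h])⟩
  intro x hx
  obtain ⟨y, hy, rfl⟩ := Finset.mem_map.mp hx
  exact e.extendSubtype_mem y hy

/-- Permutations act transitively on k-subsets, so the left side does not depend on I. Summing it
over all k-subsets and exchanging the sums gives the average. -/
theorem sum_perm_map {n k : ℕ} (f : Finset (Fin n) → ℂ) {I : Finset (Fin n)} (hI : I.card = k) :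
    ∑ π : Equiv.Perm (Fin n), f (I.map π.toEmbedding) =
      (Fintype.card (Equiv.Perm (Fin n)) : ℂ) * ((n.choose k : ℂ)⁻¹ *
        ∑ J ∈ Finset.powersetCard k Finset.univ, f J) := by
  have hch : (n.choose k : ℂ) ≠ 0 := by
    have : k ≤ n := by rw [← hI]; simpa using I.card_le_univ
    exact_mod_cast (Nat.choose_pos this).ne'
  have h1 : ∀ J ∈ Finset.powersetCard k (Finset.univ : Finset (Fin n)),
      ∑ π : Equiv.Perm (Fin n), f (J.map π.toEmbedding) =
        ∑ π : Equiv.Perm (Fin n), f (I.map π.toEmbedding) := by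
    intro J hJ
    obtain ⟨τ, rfl⟩ := exists_perm_map (hI.trans (Finset.mem_powersetCard.mp hJ).2.symm)
    refine Fintype.sum_equiv (Equiv.mulRight τ) _ _ fun π => ?_
    rw [Finset.map_map]
    rfl
  have h2 : ∀ π : Equiv.Perm (Fin n),
      ∑ J ∈ Finset.powersetCard k (Finset.univ : Finset (Fin n)), f (J.map π.toEmbedding) =
        ∑ J ∈ Finset.powersetCard k (Finset.univ : Finset (Fin n)), f J := by
    intro π
    refine Finset.sum_nbij' (fun J => J.map π.toEmbedding) (fun J => J.map π.symm.toEmbedding)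
      ?_ ?_ ?_ ?_ ?_
    · simp
    · simp
    · intro J _
      ext; simp
    · intro J _
      ext; simp
    · simp
  have h3 := Finset.sum_congr rfl h1
  rw [Finset.sum_comm, Finset.sum_congr rfl fun π _ => h2 π, Finset.sum_const, Finset.sum_const,
    Finset.card_powersetCard, Finset.card_univ, Finset.card_univ, Fintype.card_fin,
    nsmul_eq_mul, nsmul_eq_mul] at h3
  field_simp
  linear_combination -h3

theorem twirlSum_self {n : ℕ} (E : SuperOp n) (p : Fin n → Fin 4) :
    twirlSum E (pauliString p) (pauliString p) = (Fintype.card (SymCl n) : ℂ) *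
      ((3 : ℂ) ^ weight p)⁻¹ * sectorFidelity E (weight p) * 2 ^ n := by
  simp only [twirlSum, overlap_pauliString]
  rw [Fintype.sum_prod_type]
  simp only [← Finset.sum_mul, prod_sum_diagInd]
  rw [← Finset.mul_sum, sum_perm_map (zOverlap E) (I := pauliSupport p) (k := weight p) rfl, sectorFidelity,
    Fintype.card_prod, Fintype.card_fun, Fintype.card_fin]
  push_cast
  field_simp

/-- The twirl of `E` acts on the span of the weight-`k` Paulis as a multiple of the identity. -/
theorem twirlSum_pauliString {n : ℕ} (E : SuperOp n) (p : Fin n → Fin 4) (B : Op n) :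
    twirlSum E (pauliString p) B = (Fintype.card (SymCl n) : ℂ) *
      ((3 : ℂ) ^ weight p)⁻¹ * sectorFidelity E (weight p) * (pauliString p * B).trace := by
  -- Expanding B in Paulis leaves only the diagonal term p.
  have hlin : twirlSum E (pauliString p) B = ((2 : ℂ) ^ n)⁻¹ *
      ∑ q : Fin n → Fin 4, (pauliString q * B).trace *
        twirlSum E (pauliString p) (pauliString q) := by
    let φ : Op n →ₗ[ℂ] ℂ :=
      { toFun := twirlSum E (pauliString p)
        map_add' := fun A A' => by
          simp [twirlSum, add_mul, Finset.sum_add_distrib]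
        map_smul' := fun c A => by
          simp [twirlSum, Finset.mul_sum, mul_assoc] }
    change φ B = _ * ∑ q, _ * φ (pauliString q)
    conv_lhs => rw [pauliString_expansion B]
    simp only [map_smul, map_sum, smul_eq_mul]
  rw [hlin, Finset.sum_eq_single p]
  · rw [twirlSum_self]
    field_simp
  · intro q _ hq
    rw [twirlSum_eq_zero E hq.symm, mul_zero]
  · simp

/-! ### Diagonal Pauli operators and the noise fidelity -/

/-- The eigenvalue of `Z` on a basis state. -/
def zVal (a : Fin 2) : ℝ := if a = 0 then 1 else -1

theorem zVal_mul_self (a : Fin 2) : zVal a * zVal a = 1 := by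
  unfold zVal; split_ifs <;> norm_num

theorem abs_zVal (a : Fin 2) : |zVal a| = 1 := by
  unfold zVal; split_ifs <;> norm_num

theorem zString_eq_diagonal {n : ℕ} (I : Finset (Fin n)) :
    zString I = Matrix.diagonal fun b => ((∏ i ∈ I, zVal (b i) : ℝ) : ℂ) := by
  have hp : ∀ (i : Fin n) (a a' : Fin 2), pauli (if i ∈ I then 3 else 0) a a' =
      if a = a' then (if i ∈ I then (zVal a : ℂ) else 1) else 0 := by
    intro i a a'
    by_cases hi : i ∈ I <;> fin_cases a <;> fin_cases a' <;> simp [pauli, zVal, hi]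
  ext b b'
  rw [zString, pauliString, tensor_apply, Matrix.diagonal_apply]
  simp only [hp]
  split_ifs with h
  · subst h
    simp
  · obtain ⟨i, hi⟩ := Function.ne_iff.mp h
    exact Finset.prod_eq_zero (Finset.mem_univ i) (if_neg hi)

theorem zString_mul_trace {n : ℕ} (I : Finset (Fin n)) (A : Op n) :
    (zString I * A).trace = ∑ b, ((∏ i ∈ I, zVal (b i) : ℝ) : ℂ) * A b b := by
  simp [zString_eq_diagonal, Matrix.trace, Matrix.diagonal_mul]

theorem zOverlap_id {n : ℕ} (I : Finset (Fin n)) : zOverlap LinearMap.id I = 2 ^ n := by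
  have : ∀ b : Bits n, zString I b b * zString I b b = 1 := by
    intro b
    rw [zString_eq_diagonal, Matrix.diagonal_apply_eq, ← Complex.ofReal_mul,
      ← Finset.prod_mul_distrib]
    simp [zVal_mul_self]
  simp [zOverlap, this]

theorem sectorFidelity_id {n k : ℕ} (hk : k ≤ n) :
    sectorFidelity (n := n) LinearMap.id k = 1 := by
  have hch : (n.choose k : ℂ) ≠ 0 := by exact_mod_cast (Nat.choose_pos hk).ne'
  simp only [sectorFidelity, zOverlap_id, Finset.sum_const, Finset.card_powersetCard,
    Finset.card_univ, Fintype.card_fin, nsmul_eq_mul]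
  field_simp

theorem measZ_apply {n : ℕ} (A : Op n) : measZ n A = Matrix.diagonal fun b => A b b := by
  ext b b'
  simp only [measZ, LinearMap.coe_mk, AddHom.coe_mk, Matrix.sum_apply, Matrix.smul_apply,
    basisProj, Matrix.single_apply, Matrix.diagonal_apply, smul_eq_mul]
  by_cases h : b = b'
  · subst h
    simp
  · rw [if_neg h]
    exact Finset.sum_eq_zero fun c _ => by
      rw [if_neg (by rintro ⟨rfl, rfl⟩; exact h rfl), mul_zero]

theorem measZ_zString {n : ℕ} (I : Finset (Fin n)) : measZ n (zString I) = zString I := by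
  rw [measZ_apply, zString_eq_diagonal]
  simp

theorem pauli_diag_eq_zero {a : Fin 4} (h0 : a ≠ 0) (h3 : a ≠ 3) (c : Fin 2) :
    pauli a c c = 0 := by
  revert h0 h3
  fin_cases a <;> fin_cases c <;> simp [pauli]

theorem measZ_pauliString_eq_zero {n : ℕ} {p : Fin n → Fin 4} {i : Fin n} (h0 : p i ≠ 0)
    (h3 : p i ≠ 3) : measZ n (pauliString p) = 0 := by
  have : ∀ b, pauliString p b b = 0 := by
    intro b
    exact Finset.prod_eq_zero (Finset.mem_univ i) (pauli_diag_eq_zero h0 h3 _)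
  rw [measZ_apply]
  simp [this]

theorem weight_zString {n : ℕ} (I : Finset (Fin n)) :
    weight (fun i => if i ∈ I then (3 : Fin 4) else 0) = I.card := by
  simp [weight]

/-- The composite is a sum of rank-one maps, whose traces are read off directly. The measurement
channel kills strings containing X or Y and fixes those made of I and Z, which are indexed by
subsets. -/
theorem trace_comp_irrepProj {n : ℕ} (E : SuperOp n) (k : ℕ) :
    LinearMap.trace ℂ (Op n) (E ∘ₗ measZ n ∘ₗ irrepProj n k) =
      ((2 : ℂ) ^ n)⁻¹ * ∑ I ∈ Finset.powersetCard k Finset.univ, zOverlap E I := by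
  have hdecomp : E ∘ₗ measZ n ∘ₗ irrepProj n k = ((2 : ℂ) ^ n)⁻¹ •
      ∑ p : Fin n → Fin 4 with weight p = k,
        ((Matrix.traceLinearMap (Bits n) ℂ ℂ) ∘ₗ LinearMap.mulLeft ℂ (pauliString p)).smulRight
          (E (measZ n (pauliString p))) := by
    ext1 A
    simp [irrepProj, pauliString_conjTranspose]
  rw [hdecomp, map_smul, map_sum, smul_eq_mul]
  congr 1
  simp only [LinearMap.trace_smulRight, LinearMap.comp_apply, LinearMap.mulLeft_apply,
    Matrix.traceLinearMap_apply]
  symm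
  refine Finset.sum_of_injOn (fun I i => if i ∈ I then 3 else 0) ?_ ?_ ?_ ?_
  · intro I _ J _ h
    ext i
    have := congrFun h i
    by_cases hI : i ∈ I <;> by_cases hJ : i ∈ J <;> simp_all
  · intro I hI
    simpa [weight_zString] using hI
  · intro p hp hp'
    by_cases h : ∀ i, p i = 0 ∨ p i = 3
    · refine absurd ⟨pauliSupport p, ?_, ?_⟩ hp'
      · simpa [pauliSupport, weight] using hp
      · funext i
        rcases h i with h | h <;> simp [pauliSupport, h]
    · push Not at h
      obtain ⟨i, h0, h3⟩ := h
      rw [measZ_pauliString_eq_zero h0 h3]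
      simp
  · intro I _
    change _ = (zString I * E (measZ n (zString I))).trace
    rw [measZ_zString, zString_mul_trace, zOverlap]
    refine Finset.sum_congr rfl fun b _ => ?_
    rw [mul_comm]
    congr 1
    rw [zString_eq_diagonal, Matrix.diagonal_apply_eq]

theorem fidelityAt_eq {n k : ℕ} (E : SuperOp n) : fidelityAt E k = (sectorFidelity E k).re := by
  have h : LinearMap.trace ℂ (Op n) (measZ n ∘ₗ irrepProj n k) = n.choose k := by
    have := trace_comp_irrepProj (n := n) LinearMap.id k
    rw [LinearMap.id_comp] at this
    rw [this]
    simp only [zOverlap_id, Finset.sum_const, Finset.card_powersetCard,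
      Finset.card_univ, Fintype.card_fin, nsmul_eq_mul]
    field_simp
  rw [fidelityAt, h, trace_comp_irrepProj, sectorFidelity]
  congr 1
  ring

/-! ### Positivity -/

theorem IsCPTP.posSemidef {n : ℕ} {E : SuperOp n} (hE : IsCPTP E) {A : Op n}
    (hA : A.PosSemidef) : (E A).PosSemidef := by
  have h := (hE.completelyPositive 1 (A.submatrix Prod.snd Prod.snd)
    (hA.submatrix _)).submatrix fun b : Bits n => ((0 : Fin 1), b)
  exact h

theorem IsCPTP.sum_diag {n : ℕ} {E : SuperOp n} (hE : IsCPTP E) (A : Op n) :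
    ∑ b, E A b b = ∑ b, A b b := hE.tracePreserving A

/-- Each basis projector is sent to an operator whose diagonal is a probability vector, while the
diagonal entries of a Z-string have modulus one. -/
theorem norm_zOverlap_le {n : ℕ} {E : SuperOp n} (hE : IsCPTP E) (I : Finset (Fin n)) :
    ‖zOverlap E I‖ ≤ 2 ^ n := by
  have hz : ∀ b : Bits n, ‖zString I b b‖ = 1 := by
    intro b
    rw [zString_eq_diagonal, Matrix.diagonal_apply_eq, Complex.norm_real, Real.norm_eq_abs,
      Finset.abs_prod]
    simp [abs_zVal]
  have hsum : zString I = ∑ c : Bits n, zString I c c • basisProj c := by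
    have h := measZ_zString I
    exact h.symm
  have hpos : ∀ b c : Bits n, 0 ≤ E (basisProj c) b b := by
    intro b c
    refine (hE.posSemidef ?_).diag_nonneg
    have : basisProj c = Matrix.diagonal (Pi.single c (1 : ℂ)) := by
      rw [basisProj, Matrix.diagonal_single]
    rw [this]
    refine Matrix.PosSemidef.diagonal fun b => ?_
    by_cases h : b = c
    · subst h; simp
    · simp [h]
  have hone : ∀ c : Bits n, ∑ b, ‖E (basisProj c) b b‖ = 1 := by
    intro c
    have h1 : ∑ b, ((‖E (basisProj c) b b‖ : ℝ) : ℂ) = 1 := by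
      calc _ = ∑ b, E (basisProj c) b b :=
            Finset.sum_congr rfl fun b _ => (Complex.eq_coe_norm_of_nonneg (hpos b c)).symm
        _ = 1 := by
            rw [hE.sum_diag]
            simp [basisProj, Matrix.single_apply]
    exact_mod_cast h1
  calc ‖zOverlap E I‖ ≤ ∑ b, ‖E (zString I) b b‖ := by
        refine (norm_sum_le _ _).trans (Finset.sum_le_sum fun b _ => ?_)
        rw [norm_mul, hz, mul_one]
    _ ≤ ∑ b, ∑ c, ‖E (basisProj c) b b‖ := by
        refine Finset.sum_le_sum fun b _ => ?_
        conv_lhs => rw [hsum]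
        rw [map_sum, Matrix.sum_apply]
        refine (norm_sum_le _ _).trans (Finset.sum_le_sum fun c _ => ?_)
        rw [map_smul, Matrix.smul_apply, norm_smul, hz, one_mul]
    _ = 2 ^ n := by
        rw [Finset.sum_comm]
        simp [hone]

theorem abs_fidelityAt_le {n : ℕ} {E : SuperOp n} (hE : IsCPTP E) (k : ℕ) :
    |fidelityAt E k| ≤ 1 := by
  rw [fidelityAt_eq]
  refine (Complex.abs_re_le_norm _).trans ?_
  rw [sectorFidelity, norm_mul, norm_mul, norm_inv, norm_inv, norm_pow, Complex.norm_natCast,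
    Complex.norm_ofNat]
  have h : ‖∑ I ∈ Finset.powersetCard k (Finset.univ : Finset (Fin n)), zOverlap E I‖ ≤
      (n.choose k : ℝ) * 2 ^ n := by
    refine (norm_sum_le_of_le _ fun I _ => norm_zOverlap_le hE I).trans ?_
    simp
  calc _ ≤ (n.choose k : ℝ)⁻¹ * (2 ^ n)⁻¹ * ((n.choose k : ℝ) * 2 ^ n) := by gcongr
    _ = (n.choose k : ℝ)⁻¹ * (n.choose k : ℝ) := by field_simp
    -- For k > n the binomial vanishes and the product is 0. This case occurs: k = 4 is used even
    -- when n is 2 or 3.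
    _ ≤ 1 := inv_mul_le_one

/-! ### Inverting the shadow channel -/

theorem trace_mul_conjBy_basisProj {n : ℕ} (P U : Op n) (b : Bits n) :
    (P * conjBy Uᴴ (basisProj b)).trace = conjBy U P b b := by
  have : (P * conjBy Uᴴ (basisProj b)).trace = (conjBy U P * basisProj b).trace := by
    change (P * (Uᴴ * basisProj b * Uᴴᴴ)).trace = (U * P * Uᴴ * basisProj b).trace
    rw [Matrix.conjTranspose_conjTranspose, ← Matrix.mul_assoc, Matrix.trace_mul_comm]
    simp only [Matrix.mul_assoc]
  rw [this, basisProj, Matrix.trace_mul_single]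
  simp

/-- The shadow channel is the twirl of the noiseless measurement, so the general twirl formula
diagonalizes it. -/
theorem trace_mul_shadowChannel {n : ℕ} (P B : Op n) :
    (P * shadowChannel n B).trace =
      (Fintype.card (SymCl n) : ℂ)⁻¹ * twirlSum LinearMap.id P B := by
  simp only [shadowChannel, LinearMap.smul_apply, LinearMap.sum_apply, LinearMap.comp_apply,
    Matrix.mul_smul, Matrix.trace_smul, smul_eq_mul, Finset.mul_sum, Matrix.trace_sum, twirlSum]
  refine Finset.sum_congr rfl fun g _ => ?_
  simp only [measZ, LinearMap.coe_mk, AddHom.coe_mk, map_sum, map_smul, Finset.mul_sum,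
    Matrix.mul_smul, Matrix.trace_sum, Matrix.trace_smul, trace_mul_conjBy_basisProj,
    smul_eq_mul, LinearMap.id_apply]

theorem card_symCl_ne_zero (n : ℕ) : (Fintype.card (SymCl n) : ℂ) ≠ 0 := by
  exact_mod_cast Fintype.card_ne_zero

theorem weight_le {n : ℕ} (p : Fin n → Fin 4) : weight p ≤ n := by
  simpa [weight] using (Finset.univ.filter fun i => p i ≠ 0).card_le_univ

theorem trace_pauliString_mul_shadowChannel {n : ℕ} (p : Fin n → Fin 4) (B : Op n) :
    (pauliString p * shadowChannel n B).trace =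
      ((3 : ℂ) ^ weight p)⁻¹ * (pauliString p * B).trace := by
  rw [trace_mul_shadowChannel, twirlSum_pauliString, sectorFidelity_id (weight_le p)]
  have := card_symCl_ne_zero n
  field_simp

/-- `Ring.inverse` is zero on non-units, so invertibility is what gives `shadow` its meaning. All
eigenvalues 3^{-k} are nonzero, hence the channel is injective on a finite-dimensional space. -/
theorem isUnit_shadowChannel (n : ℕ) :
    IsUnit (M := Module.End ℂ (Op n)) (shadowChannel n) := by
  rw [LinearMap.isUnit_iff_ker_eq_bot, LinearMap.ker_eq_bot']
  intro B hB
  rw [pauliString_expansion B]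
  have : ∀ p : Fin n → Fin 4, (pauliString p * B).trace = 0 := by
    intro p
    have h := trace_pauliString_mul_shadowChannel p B
    rw [hB, Matrix.mul_zero, Matrix.trace_zero] at h
    simpa using h.symm
  simp [this]

theorem trace_pauliString_mul_shadow {n : ℕ} (p : Fin n → Fin 4) (x : SymCl n × Bits n) :
    (pauliString p * shadow x).trace =
      (3 : ℂ) ^ weight p * conjBy (groupUnitary x.1) (pauliString p) x.2 x.2 := by
  have h : shadowChannel n (shadow x) = conjBy (groupUnitary x.1)ᴴ (basisProj x.2) :=
    LinearMap.congr_fun (Ring.mul_inverse_cancel (M₀ := Module.End ℂ (Op n)) (shadowChannel n)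
      (isUnit_shadowChannel n)) (conjBy (groupUnitary x.1)ᴴ (basisProj x.2))
  rw [← trace_mul_conjBy_basisProj, ← h, trace_pauliString_mul_shadowChannel]
  field_simp

/-! ### Single-run statistics -/

theorem conjBy_isHermitian {n : ℕ} (U : Op n) {A : Op n} (hA : A.IsHermitian) :
    (conjBy U A).IsHermitian :=
  Matrix.isHermitian_mul_mul_conjTranspose U hA

theorem pauliString_isHermitian {n : ℕ} (p : Fin n → Fin 4) : (pauliString p).IsHermitian :=
  pauliString_conjTranspose p

theorem conjBy_pauliString_diag {n : ℕ} (U : Op n) (p : Fin n → Fin 4) (b : Bits n) :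
    ((conjBy U (pauliString p) b b).re : ℂ) = conjBy U (pauliString p) b b :=
  (conjBy_isHermitian U (pauliString_isHermitian p)).coe_re_apply_self b

theorem shotEst_pauliString {n : ℕ} (p : Fin n → Fin 4) (x : SymCl n × Bits n) :
    shotEst (pauliString p) x =
      3 ^ weight p * (conjBy (groupUnitary x.1) (pauliString p) x.2 x.2).re := by
  rw [shotEst, trace_pauliString_mul_shadow, ← conjBy_pauliString_diag]
  norm_cast

theorem conjBy_posSemidef {n : ℕ} (U : Op n) {ρ : Op n} (h : ρ.PosSemidef) :
    (conjBy U ρ).PosSemidef :=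
  h.mul_mul_conjTranspose_same U

theorem outcome_nonneg {n : ℕ} {E : SuperOp n} {ρ : Op n} (hE : IsCPTP E) (hρ : IsState ρ)
    (x : SymCl n × Bits n) : 0 ≤ E (conjBy (groupUnitary x.1) ρ) x.2 x.2 :=
  (hE.posSemidef (conjBy_posSemidef _ hρ.posSemidef)).diag_nonneg

theorem shotProb_nonneg {n : ℕ} {E : SuperOp n} {ρ : Op n} (hE : IsCPTP E) (hρ : IsState ρ)
    (x : SymCl n × Bits n) : 0 ≤ shotProb E ρ x :=
  mul_nonneg (by positivity) (Complex.nonneg_iff.mp (outcome_nonneg hE hρ x)).1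

theorem sum_shotProb {n : ℕ} {E : SuperOp n} {ρ : Op n} (hE : IsCPTP E) (hρ : IsState ρ) :
    ∑ x, shotProb E ρ x = 1 := by
  have h1 : ∀ g : SymCl n, ∑ b, (E (conjBy (groupUnitary g) ρ) b b).re = 1 := by
    intro g
    rw [← Complex.re_sum, hE.sum_diag]
    have := (trace_conjBy g ρ).trans hρ.trace_eq_one
    rw [Matrix.trace] at this
    simp only [Matrix.diag_apply] at this
    rw [this, Complex.one_re]
  simp only [shotProb]
  rw [← Finset.mul_sum, Fintype.sum_prod_type]
  simp only [h1]
  rw [Finset.sum_const, Finset.card_univ, nsmul_eq_mul, mul_one]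
  exact inv_mul_cancel₀ (by exact_mod_cast Fintype.card_ne_zero)

theorem trace_pauliString_im {n : ℕ} {ρ : Op n} (hρ : IsState ρ) (p : Fin n → Fin 4) :
    (pauliString p * ρ).trace.im = 0 := by
  rw [← Complex.conj_eq_iff_im, starRingEnd_apply, ← Matrix.trace_conjTranspose,
    Matrix.conjTranspose_mul, pauliString_conjTranspose, hρ.posSemidef.isHermitian.eq,
    Matrix.trace_mul_comm]

/-- As P² = 1, the operators 1 ± P are half their own squares, so their expectations in ρ are
nonnegative. -/
theorem abs_trace_pauliString_le {n : ℕ} {ρ : Op n} (hρ : IsState ρ) (p : Fin n → Fin 4) :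
    |(pauliString p * ρ).trace.re| ≤ 1 := by
  have key : ∀ s : ℂ, star s = s → s * s = 1 → 0 ≤ (1 + s * (pauliString p * ρ).trace).re := by
    intro s hs hs'
    have h := (hρ.posSemidef.mul_mul_conjTranspose_same (1 + s • pauliString p)).trace_nonneg
    rw [Matrix.conjTranspose_add, Matrix.conjTranspose_smul, pauliString_conjTranspose,
      Matrix.conjTranspose_one, hs, Matrix.trace_mul_comm, ← Matrix.mul_assoc] at h
    have h2 : (1 + s • pauliString p) * (1 + s • pauliString p) =
        (2 : ℂ) • (1 + s • pauliString p) := by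
      have h3 : (s • pauliString p) * (s • pauliString p) = 1 := by
        rw [Matrix.smul_mul, Matrix.mul_smul, smul_smul, hs', pauliString_mul_self, one_smul]
      rw [Matrix.add_mul, Matrix.mul_add, Matrix.mul_add, h3, two_smul]
      simp only [Matrix.mul_one, Matrix.one_mul]
      abel
    rw [h2, Matrix.smul_mul, Matrix.add_mul, Matrix.one_mul, Matrix.smul_mul, Matrix.trace_smul,
      Matrix.trace_add, Matrix.trace_smul, hρ.trace_eq_one, smul_eq_mul, smul_eq_mul] at h
    have := (Complex.nonneg_iff.mp h).1
    simp only [Complex.mul_re, Complex.re_ofNat, Complex.im_ofNat, zero_mul, sub_zero] at this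
    simp only [Complex.add_re, Complex.mul_re] at this ⊢
    linarith
  have h1 := key 1 (by simp) (by simp)
  have h2 := key (-1) (by simp) (by simp)
  simp at h1 h2
  exact abs_le.mpr ⟨by linarith, by linarith⟩

/-- In expectation, the noisy single-run estimate of a weight-`k` Pauli operator is damped by the
noise fidelity of the weight-`k` sector. -/
theorem shotMean_pauliString {n : ℕ} {E : SuperOp n} {ρ : Op n} (hE : IsCPTP E) (hρ : IsState ρ)
    (p : Fin n → Fin 4) : shotMean E ρ (shotEst (pauliString p)) =
      fidelityAt E (weight p) * (pauliString p * ρ).trace.re := by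
  have h : ((shotMean E ρ (shotEst (pauliString p)) : ℝ) : ℂ) =
      (Fintype.card (SymCl n) : ℂ)⁻¹ * 3 ^ weight p * twirlSum E (pauliString p) ρ := by
    rw [shotMean, Fintype.sum_prod_type, twirlSum]
    push_cast
    simp only [Finset.mul_sum]
    refine Finset.sum_congr rfl fun g _ => Finset.sum_congr rfl fun b _ => ?_
    rw [shotProb, shotEst_pauliString]
    push_cast
    -- Outcome weights are nonnegative, so taking real parts in `shotProb` loses nothing.
    have h1 : ((E (conjBy (groupUnitary g) ρ) b b).re : ℂ) = E (conjBy (groupUnitary g) ρ) b b :=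
      Complex.ext rfl ((Complex.nonneg_iff.mp (outcome_nonneg hE hρ (g, b))).2)
    rw [conjBy_pauliString_diag, h1]
    ring
  rw [twirlSum_pauliString] at h
  have h' : ((shotMean E ρ (shotEst (pauliString p)) : ℝ) : ℂ) =
      sectorFidelity E (weight p) * (pauliString p * ρ).trace := by
    rw [h]
    have := card_symCl_ne_zero n
    field_simp
  have := congrArg Complex.re h'
  rwa [Complex.ofReal_re, Complex.mul_re, trace_pauliString_im hρ, mul_zero, sub_zero,
    ← fidelityAt_eq] at this

/-! Elementary properties of means and variances. -/

theorem shotMean_add {n : ℕ} (E : SuperOp n) (ρ : Op n) (f g : SymCl n × Bits n → ℝ) :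
    shotMean E ρ (fun x => f x + g x) = shotMean E ρ f + shotMean E ρ g := by
  simp [shotMean, mul_add, Finset.sum_add_distrib]

theorem shotMean_const_mul {n : ℕ} (E : SuperOp n) (ρ : Op n) (c : ℝ)
    (f : SymCl n × Bits n → ℝ) : shotMean E ρ (fun x => c * f x) = c * shotMean E ρ f := by
  simp only [shotMean, Finset.mul_sum]
  exact Finset.sum_congr rfl fun x _ => by ring

theorem shotMean_sum {n : ℕ} {ι : Type*} (E : SuperOp n) (ρ : Op n) (s : Finset ι)
    (f : ι → SymCl n × Bits n → ℝ) :
    shotMean E ρ (fun x => ∑ i ∈ s, f i x) = ∑ i ∈ s, shotMean E ρ (f i) := by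
  simp only [shotMean, Finset.mul_sum]
  exact Finset.sum_comm

theorem shotMean_const {n : ℕ} {E : SuperOp n} {ρ : Op n} (hE : IsCPTP E) (hρ : IsState ρ)
    (c : ℝ) : shotMean E ρ (fun _ => c) = c := by
  rw [shotMean, ← Finset.sum_mul, sum_shotProb hE hρ, one_mul]

theorem shotMean_mono {n : ℕ} {E : SuperOp n} {ρ : Op n} (hE : IsCPTP E) (hρ : IsState ρ)
    {f g : SymCl n × Bits n → ℝ} (h : ∀ x, f x ≤ g x) : shotMean E ρ f ≤ shotMean E ρ g :=
  Finset.sum_le_sum fun x _ => mul_le_mul_of_nonneg_left (h x) (shotProb_nonneg hE hρ x)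

theorem shotVar_le {n : ℕ} {E : SuperOp n} {ρ : Op n} (hE : IsCPTP E) (hρ : IsState ρ)
    (f : SymCl n × Bits n → ℝ) : shotVar E ρ f ≤ shotMean E ρ fun x => f x ^ 2 := by
  set μ := shotMean E ρ f with hμ
  have h : shotMean E ρ (fun x => f x ^ 2) =
      shotVar E ρ f + (2 * μ * shotMean E ρ f + -μ ^ 2) := by
    rw [shotVar, ← shotMean_const hE hρ (-μ ^ 2), ← shotMean_const_mul, ← shotMean_add,
      ← shotMean_add]
    congr 1
    funext x
    ring
  rw [h, ← hμ]
  nlinarith [sq_nonneg μ]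

theorem shotEst_sum {n : ℕ} {ι : Type*} (s : Finset ι) (O : ι → Op n) (x : SymCl n × Bits n) :
    shotEst (∑ i ∈ s, O i) x = ∑ i ∈ s, shotEst (O i) x := by
  simp [shotEst, Finset.sum_mul, Matrix.trace_sum]

theorem shotEst_two_smul {n : ℕ} (O : Op n) (x : SymCl n × Bits n) :
    shotEst ((2 : ℂ) • O) x = 2 * shotEst O x := by
  simp [shotEst]

/-! ### Symmetric functions -/

theorem two_mul_sum_lt {n : ℕ} (x : Fin n → ℝ) :
    2 * ∑ i, ∑ j with i < j, x i * x j = (∑ i, x i) ^ 2 - ∑ i, x i ^ 2 := by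
  have h : (∑ i, x i) ^ 2 = ∑ i, ∑ j, ((if i < j then x i * x j else 0) +
      (if j < i then x j * x i else 0) + if i = j then x i ^ 2 else 0) := by
    rw [sq, Finset.sum_mul_sum]
    refine Finset.sum_congr rfl fun i _ => Finset.sum_congr rfl fun j _ => ?_
    rcases lt_trichotomy i j with h | h | h
    · simp [h, h.not_gt, h.ne]
    · subst h; simp [sq]
    · simp [h, h.not_gt, h.ne', mul_comm]
  simp only [Finset.sum_add_distrib] at h
  rw [Finset.sum_comm (f := fun i j => if j < i then x j * x i else 0)] at h
  simp only [Finset.sum_ite_eq, Finset.mem_univ, if_true] at h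
  simp only [Finset.sum_filter]
  linarith

theorem esymm_four {n : ℕ} (x : Fin n → ℝ) :
    24 * ∑ I ∈ Finset.powersetCard 4 Finset.univ, ∏ i ∈ I, x i =
      (∑ i, x i) ^ 4 - 6 * (∑ i, x i) ^ 2 * (∑ i, x i ^ 2) + 3 * (∑ i, x i ^ 2) ^ 2 +
        8 * (∑ i, x i) * (∑ i, x i ^ 3) - 6 * ∑ i, x i ^ 4 := by
  have hN := fun k => congrArg (MvPolynomial.aeval x)
    (MvPolynomial.mul_esymm_eq_sum (Fin n) ℝ k)
  have h2 := hN 2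
  have h3 := hN 3
  have h4 := hN 4
  have s2 : (Finset.HasAntidiagonal.antidiagonal 2).filter (fun a : ℕ × ℕ => a.1 < 2) =
      ({(0, 2), (1, 1)} : Finset (ℕ × ℕ)) := by decide
  have s3 : (Finset.HasAntidiagonal.antidiagonal 3).filter (fun a : ℕ × ℕ => a.1 < 3) =
      ({(0, 3), (1, 2), (2, 1)} : Finset (ℕ × ℕ)) := by decide
  have s4 : (Finset.HasAntidiagonal.antidiagonal 4).filter (fun a : ℕ × ℕ => a.1 < 4) =
      ({(0, 4), (1, 3), (2, 2), (3, 1)} : Finset (ℕ × ℕ)) := by decide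
  rw [s2] at h2
  simp [MvPolynomial.psum, MvPolynomial.esymm_zero] at h2
  rw [s3] at h3
  simp [MvPolynomial.psum, MvPolynomial.esymm_zero] at h3
  rw [s4] at h4
  simp [MvPolynomial.psum, MvPolynomial.esymm_zero] at h4
  have he4 : (MvPolynomial.eval x) (MvPolynomial.esymm (Fin n) ℝ 4) =
      ∑ I ∈ Finset.powersetCard 4 Finset.univ, ∏ i ∈ I, x i := by
    simp [MvPolynomial.esymm]
  rw [← he4]
  -- The multipliers eliminate the second and third elementary symmetric functions from Newton's
  -- identities.
  linear_combination 6 * h4 + 2 * (∑ i, x i) * h3 +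
    ((∑ i, x i) ^ 2 - 3 * ∑ i, x i ^ 2) * h2

/-! ### Diagonal observables -/

theorem pauliZ_eq_zString {n : ℕ} (i : Fin n) : pauliZ i = zString {i} := by
  rw [pauliZ, zString]
  refine congrArg pauliString (funext fun j => ?_)
  by_cases h : j = i
  · subst h; simp
  · simp [h]

theorem pauliZ_mul_pauliZ {n : ℕ} {i j : Fin n} (h : i ≠ j) :
    pauliZ i * pauliZ j = zString {i, j} := by
  rw [pauliZ_eq_zString, pauliZ_eq_zString]
  simp only [zString_eq_diagonal, Matrix.diagonal_mul_diagonal]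
  refine congrArg Matrix.diagonal (funext fun b => ?_)
  simp [Finset.prod_pair h]

theorem cliffConj_pauli_three_diag (C : Cl1) (b : Fin 2) :
    ∃ v : ℝ, (v = 0 ∨ v = 1 ∨ v = -1) ∧ cliffConj C (pauli 3) b b = v := by
  obtain ⟨d, -, h | h⟩ := cliffConj_pauli_mem C (a := 3) (by decide)
  all_goals
    rw [h]
    fin_cases d <;> fin_cases b <;> simp [pauli]

/-- Here v i is the diagonal entry of the rotated Z of qubit i at the bit read at its permuted
position. One v serves all I at once, which turns estimator identities into identities of symmetric
polynomials. -/
theorem exists_localVal {n : ℕ} (x : SymCl n × Bits n) :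
    ∃ v : Fin n → ℝ, (∀ i, v i = 0 ∨ v i = 1 ∨ v i = -1) ∧
      ∀ I, shotEst (zString I) x = ∏ i ∈ I, (3 * v i) := by
  choose v hv hv' using fun i => cliffConj_pauli_three_diag (x.1.2 i) (x.2 (x.1.1 i))
  refine ⟨v, hv, fun I => ?_⟩
  have : conjBy (groupUnitary x.1) (pauliString fun i => if i ∈ I then 3 else 0) x.2 x.2 =
      ((∏ i ∈ I, v i : ℝ) : ℂ) := by
    rw [pauliString, conjBy_groupUnitary_tensor, tensor_apply, ← Equiv.prod_comp x.1.1]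
    push_cast
    rw [← Finset.prod_subset (Finset.subset_univ I)]
    · refine Finset.prod_congr rfl fun i hi => ?_
      simp [hi, ← hv']
    · intro i _ hi
      simp [hi, show pauli 0 = 1 from rfl, cliffConj_one]
  rw [zString, shotEst_pauliString, weight_zString, Finset.prod_mul_distrib, Finset.prod_const,
    this, Complex.ofReal_re]

theorem shotEst_symOp_one {n : ℕ} (x : SymCl n × Bits n) :
    shotEst (symOp n 1) x = ∑ i, shotEst (zString {i}) x := by
  simp only [symOp, shotEst_sum, pauliZ_eq_zString]

theorem shotEst_symOp_two {n : ℕ} (x : SymCl n × Bits n) :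
    shotEst (symOp n 2) x = 2 * ∑ i, ∑ j with i < j, shotEst (zString {i, j}) x := by
  simp only [symOp, shotEst_two_smul, shotEst_sum]
  refine congrArg _ (Finset.sum_congr rfl fun i _ => Finset.sum_congr rfl fun j hj => ?_)
  rw [pauliZ_mul_pauliZ (Finset.mem_filter.mp hj).2.ne]

theorem shotMean_zString {n : ℕ} {E : SuperOp n} {ρ : Op n} (hE : IsCPTP E) (hρ : IsState ρ)
    (I : Finset (Fin n)) : shotMean E ρ (shotEst (zString I)) =
      fidelityAt E I.card * (zString I * ρ).trace.re := by
  rw [zString, shotMean_pauliString hE hρ, weight_zString]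

/-- The magnetization of a basis state. -/
def zSum {n : ℕ} (b : Bits n) : ℝ := ∑ i, zVal (b i)

theorem trace_zString_re {n : ℕ} (ρ : Op n) (I : Finset (Fin n)) :
    (zString I * ρ).trace.re = ∑ b, (∏ i ∈ I, zVal (b i)) * (ρ b b).re := by
  rw [zString_mul_trace, Complex.re_sum]
  simp only [Complex.re_ofReal_mul]

theorem zSum_eq_of_diag_ne_zero {n : ℕ} {ρ : Op n} {m : ℝ}
    (h : magnetization n * ρ = (m : ℂ) • ρ) {b : Bits n} (hb : (ρ b b).re ≠ 0) :
    zSum b = m := by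
  have hM : magnetization n = Matrix.diagonal fun b => ((zSum b : ℝ) : ℂ) := by
    simp only [magnetization, pauliZ_eq_zString, zString_eq_diagonal, Finset.prod_singleton]
    ext b b'
    rw [Matrix.sum_apply]
    by_cases hbb : b = b'
    · subst hbb
      simp [zSum]
    · simp [hbb]
  have := congrArg Complex.re (congrFun (congrFun h b) b)
  rw [hM, Matrix.diagonal_mul, Matrix.smul_apply, smul_eq_mul, Complex.re_ofReal_mul,
    Complex.re_ofReal_mul] at this
  exact mul_right_cancel₀ hb this

theorem sum_diag_re {n : ℕ} {ρ : Op n} (hρ : IsState ρ) : ∑ b, (ρ b b).re = 1 := by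
  rw [← Complex.re_sum]
  exact (congrArg Complex.re hρ.trace_eq_one).trans Complex.one_re

/-- The diagonal of ρ has total mass one and vanishes off the bit strings of magnetization m. -/
theorem sum_mul_diag {n : ℕ} {ρ : Op n} {m : ℝ} (hρ : IsState ρ)
    (h : magnetization n * ρ = (m : ℂ) • ρ) (f : Bits n → ℝ) (c : ℝ)
    (hf : ∀ b, zSum b = m → f b = c) : ∑ b, f b * (ρ b b).re = c := by
  calc ∑ b, f b * (ρ b b).re = ∑ b, c * (ρ b b).re := by
        refine Finset.sum_congr rfl fun b _ => ?_
        by_cases hb : (ρ b b).re = 0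
        · simp [hb]
        · rw [hf b (zSum_eq_of_diag_ne_zero h hb)]
    _ = c := by rw [← Finset.mul_sum, sum_diag_re hρ, mul_one]

theorem sum_zVal_sq {n : ℕ} (b : Bits n) : ∑ i, zVal (b i) ^ 2 = n := by
  simp [sq, zVal_mul_self]

theorem sum_trace_one {n : ℕ} {ρ : Op n} {m : ℝ} (hρ : IsState ρ)
    (h : magnetization n * ρ = (m : ℂ) • ρ) : ∑ i, (zString {i} * ρ).trace.re = m := by
  simp only [trace_zString_re, Finset.prod_singleton]
  rw [Finset.sum_comm]
  simp only [← Finset.sum_mul]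
  exact sum_mul_diag hρ h zSum m fun b hb => hb

theorem sum_trace_two {n : ℕ} {ρ : Op n} {m : ℝ} (hρ : IsState ρ)
    (h : magnetization n * ρ = (m : ℂ) • ρ) :
    2 * ∑ i, ∑ j with i < j, (zString {i, j} * ρ).trace.re = m ^ 2 - n := by
  have h1 : ∀ i : Fin n, ∀ j ∈ Finset.univ.filter (fun j => i < j),
      (zString {i, j} * ρ).trace.re = ∑ b, zVal (b i) * zVal (b j) * (ρ b b).re := by
    intro i j hj
    rw [trace_zString_re]
    simp only [Finset.prod_pair (Finset.mem_filter.mp hj).2.ne]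
  rw [Finset.sum_congr rfl fun i _ => Finset.sum_congr rfl (h1 i)]
  have h2 : 2 * ∑ i : Fin n, ∑ j with i < j, ∑ b : Bits n, zVal (b i) * zVal (b j) * (ρ b b).re =
      ∑ b : Bits n, (2 * ∑ i, ∑ j with i < j, zVal (b i) * zVal (b j)) * (ρ b b).re := by
    simp only [Finset.mul_sum, Finset.sum_mul]
    rw [Finset.sum_comm]
    refine Finset.sum_congr rfl fun i _ => ?_
    rw [Finset.sum_comm]
    exact Finset.sum_congr rfl fun j _ => Finset.sum_congr rfl fun b _ => by ring
  rw [h2]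
  refine sum_mul_diag hρ h _ _ fun b hb => ?_
  rw [two_mul_sum_lt fun i => zVal (b i), sum_zVal_sq, ← hb, zSum]

theorem sum_trace_four {n : ℕ} {ρ : Op n} {m : ℝ} (hρ : IsState ρ)
    (h : magnetization n * ρ = (m : ℂ) • ρ) :
    24 * ∑ I ∈ Finset.powersetCard 4 Finset.univ, (zString I * ρ).trace.re =
      m ^ 4 - 6 * m ^ 2 * n + 3 * n ^ 2 + 8 * m ^ 2 - 6 * n := by
  simp only [trace_zString_re]
  rw [Finset.sum_comm, Finset.mul_sum]
  simp only [← Finset.sum_mul, ← mul_assoc]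
  refine sum_mul_diag hρ h _ _ fun b hb => ?_
  rw [esymm_four fun i => zVal (b i)]
  have h3 : ∀ i, zVal (b i) ^ 3 = zVal (b i) := fun i => by
    rw [pow_succ, sq, zVal_mul_self, one_mul]
  have h4 : ∀ i, zVal (b i) ^ 4 = 1 := fun i => by
    rw [show 4 = 2 * 2 from rfl, pow_mul, sq (zVal (b i)), zVal_mul_self, one_pow]
  simp only [h3, h4, sum_zVal_sq]
  rw [show ∑ i, zVal (b i) = m from hb]
  simp
  ring

theorem trace_symOp_one {n : ℕ} {ρ : Op n} {m : ℝ} (hρ : IsState ρ)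
    (h : magnetization n * ρ = (m : ℂ) • ρ) : (symOp n 1 * ρ).trace = m := by
  rw [show symOp n 1 = magnetization n from rfl, h, Matrix.trace_smul, hρ.trace_eq_one]
  simp

theorem trace_symOp_two {n : ℕ} {ρ : Op n} {m : ℝ} (hρ : IsState ρ)
    (h : magnetization n * ρ = (m : ℂ) • ρ) :
    (symOp n 2 * ρ).trace = ((m ^ 2 - n : ℝ) : ℂ) := by
  have h1 : ∀ I : Finset (Fin n), (zString I * ρ).trace = ((zString I * ρ).trace.re : ℂ) :=
    fun I => Complex.ext rfl (trace_pauliString_im hρ _)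
  rw [← sum_trace_two hρ h]
  simp only [symOp, Matrix.smul_mul, Matrix.trace_smul, Finset.sum_mul, Matrix.trace_sum,
    smul_eq_mul]
  push_cast
  refine congrArg _ (Finset.sum_congr rfl fun i _ => Finset.sum_congr rfl fun j hj => ?_)
  rw [pauliZ_mul_pauliZ (Finset.mem_filter.mp hj).2.ne]
  exact h1 _

theorem exists_int_magnetization {n : ℕ} {ρ : Op n} {m : ℝ} (hρ : IsState ρ)
    (h : magnetization n * ρ = (m : ℂ) • ρ) : ∃ k : ℤ, m = k := by
  obtain ⟨b, -, hb⟩ := Finset.exists_ne_zero_of_sum_ne_zero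
    ((sum_diag_re hρ).trans_ne one_ne_zero)
  refine ⟨∑ i, if b i = 0 then 1 else -1, ?_⟩
  rw [← zSum_eq_of_diag_ne_zero h hb, zSum]
  push_cast
  rfl

/-! ### Moments of the symmetry estimators -/

theorem exists_localVal_symOp {n : ℕ} (x : SymCl n × Bits n) :
    ∃ v : Fin n → ℝ, (∀ i, v i = 0 ∨ v i = 1 ∨ v i = -1) ∧
      shotEst (symOp n 1) x = 3 * ∑ i, v i ∧
      shotEst (symOp n 2) x = 9 * ((∑ i, v i) ^ 2 - ∑ i, v i ^ 2) ∧
      ∑ I ∈ Finset.powersetCard 4 Finset.univ, shotEst (zString I) x =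
        81 * ∑ I ∈ Finset.powersetCard 4 Finset.univ, ∏ i ∈ I, v i := by
  obtain ⟨v, hv, h⟩ := exists_localVal x
  refine ⟨v, hv, ?_, ?_, ?_⟩
  · simp only [shotEst_symOp_one, h, Finset.prod_singleton, Finset.mul_sum]
  · rw [shotEst_symOp_two, ← two_mul_sum_lt]
    simp only [Finset.mul_sum]
    refine Finset.sum_congr rfl fun i _ => Finset.sum_congr rfl fun j hj => ?_
    rw [h, Finset.prod_pair (Finset.mem_filter.mp hj).2.ne]
    ring
  · rw [Finset.mul_sum]
    refine Finset.sum_congr rfl fun I hI => ?_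
    rw [h, Finset.prod_mul_distrib, Finset.prod_const, (Finset.mem_powersetCard.mp hI).2]
    norm_num

theorem abs_sum_localVal_le {n : ℕ} {v : Fin n → ℝ} (hv : ∀ i, v i = 0 ∨ v i = 1 ∨ v i = -1) :
    |∑ i, v i| ≤ n := by
  calc |∑ i, v i| ≤ ∑ i, |v i| := Finset.abs_sum_le_sum_abs _ _
    _ ≤ ∑ _i : Fin n, (1 : ℝ) := Finset.sum_le_sum fun i _ => by
        rcases hv i with h | h | h <;> simp [h]
    _ = n := by simp

theorem sum_localVal_sq_nonneg {n : ℕ} (v : Fin n → ℝ) : 0 ≤ ∑ i, v i ^ 2 :=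
  Finset.sum_nonneg fun _ _ => sq_nonneg _

theorem sum_localVal_sq_le {n : ℕ} {v : Fin n → ℝ} (hv : ∀ i, v i = 0 ∨ v i = 1 ∨ v i = -1) :
    ∑ i, v i ^ 2 ≤ n := by
  calc ∑ i, v i ^ 2 ≤ ∑ _i : Fin n, (1 : ℝ) := Finset.sum_le_sum fun i _ => by
        rcases hv i with h | h | h <;> simp [h]
    _ = n := by simp

theorem abs_shotEst_symOp_one_le {n : ℕ} (x : SymCl n × Bits n) :
    |shotEst (symOp n 1) x| ≤ 3 * n := by
  obtain ⟨v, hv, h, -⟩ := exists_localVal_symOp x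
  rw [h, abs_mul, abs_of_pos (by norm_num : (0 : ℝ) < 3)]
  exact mul_le_mul_of_nonneg_left (abs_sum_localVal_le hv) (by norm_num)

theorem abs_shotEst_symOp_two_le {n : ℕ} (hn : 1 ≤ n) (x : SymCl n × Bits n) :
    |shotEst (symOp n 2) x| ≤ 9 * (n : ℝ) ^ 2 := by
  obtain ⟨v, hv, -, h, -⟩ := exists_localVal_symOp x
  have h1 := abs_sum_localVal_le hv
  have h2 := sum_localVal_sq_nonneg v
  have h3 := sum_localVal_sq_le hv
  have hn' : (1 : ℝ) ≤ n := by exact_mod_cast hn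
  have h4 : (∑ i, v i) ^ 2 ≤ (n : ℝ) ^ 2 := sq_le_sq' (abs_le.mp h1).1 (abs_le.mp h1).2
  rw [h, abs_le]
  constructor <;> nlinarith [sq_nonneg (∑ i, v i)]

/-- With p₁, q the sums of v and v², this is 9p₁² = 9(p₁² - q) + 9q and q ≤ n. -/
theorem sq_shotEst_symOp_one_le {n : ℕ} (x : SymCl n × Bits n) :
    shotEst (symOp n 1) x ^ 2 ≤ shotEst (symOp n 2) x + 9 * n := by
  obtain ⟨v, hv, h1, h2, -⟩ := exists_localVal_symOp x
  have h3 := sum_localVal_sq_le hv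
  rw [h1, h2]
  linarith

/-- With p₁, q the sums of v and v², and v³ = v, the square 81(p₁² - q)² exceeds the weight-4 sum by
81(4p₁²q - 2q² - 8p₁² + 6q), at most 324np₁² + 486n. The first term is 36n times the squared
estimate of S₁. -/
theorem sq_shotEst_symOp_two_le {n : ℕ} (x : SymCl n × Bits n) :
    shotEst (symOp n 2) x ^ 2 ≤
      24 * ∑ I ∈ Finset.powersetCard 4 Finset.univ, shotEst (zString I) x +
        (36 * n * shotEst (symOp n 1) x ^ 2 + 486 * n) := by
  obtain ⟨v, hv, h1, h2, h4⟩ := exists_localVal_symOp x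
  have hq0 := sum_localVal_sq_nonneg v
  have hq := sum_localVal_sq_le hv
  have e := esymm_four v
  have e3 : ∀ i, v i ^ 3 = v i := fun i => by
    rcases hv i with h | h | h <;> rw [h] <;> norm_num
  have e4 : ∀ i, v i ^ 4 = v i ^ 2 := fun i => by
    rcases hv i with h | h | h <;> rw [h] <;> norm_num
  simp only [e3, e4] at e
  rw [h1, h2, h4]
  have h5 : 0 ≤ (∑ i, v i) ^ 2 * ((n : ℝ) - ∑ i, v i ^ 2) :=
    mul_nonneg (sq_nonneg _) (by linarith)
  nlinarith [sq_nonneg (∑ i, v i), sq_nonneg (∑ i, v i ^ 2)]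

theorem shotMean_symOp_one {n : ℕ} {E : SuperOp n} {ρ : Op n} {m : ℝ} (hE : IsCPTP E)
    (hρ : IsState ρ) (h : magnetization n * ρ = (m : ℂ) • ρ) :
    shotMean E ρ (shotEst (symOp n 1)) = fidelityAt E 1 * m := by
  rw [show shotEst (symOp n 1) = fun x => ∑ i, shotEst (zString {i}) x from
    funext shotEst_symOp_one, shotMean_sum, ← sum_trace_one hρ h, Finset.mul_sum]
  exact Finset.sum_congr rfl fun i _ => by rw [shotMean_zString hE hρ, Finset.card_singleton]

theorem shotMean_symOp_two {n : ℕ} {E : SuperOp n} {ρ : Op n} {m : ℝ} (hE : IsCPTP E)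
    (hρ : IsState ρ) (h : magnetization n * ρ = (m : ℂ) • ρ) :
    shotMean E ρ (shotEst (symOp n 2)) = fidelityAt E 2 * (m ^ 2 - n) := by
  rw [show shotEst (symOp n 2) = fun x => 2 * ∑ i, ∑ j with i < j, shotEst (zString {i, j}) x from
    funext shotEst_symOp_two, shotMean_const_mul, shotMean_sum, ← sum_trace_two hρ h,
    mul_left_comm]
  refine congrArg (2 * ·) ?_
  rw [Finset.mul_sum]
  refine Finset.sum_congr rfl fun i _ => ?_
  rw [shotMean_sum, Finset.mul_sum]
  refine Finset.sum_congr rfl fun j hj => ?_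
  rw [shotMean_zString hE hρ, Finset.card_pair (Finset.mem_filter.mp hj).2.ne]

theorem shotMean_sum_four {n : ℕ} {E : SuperOp n} {ρ : Op n} {m : ℝ} (hE : IsCPTP E)
    (hρ : IsState ρ) (h : magnetization n * ρ = (m : ℂ) • ρ) :
    shotMean E ρ (fun x =>
      24 * ∑ I ∈ Finset.powersetCard 4 Finset.univ, shotEst (zString I) x) =
      fidelityAt E 4 * (m ^ 4 - 6 * m ^ 2 * n + 3 * n ^ 2 + 8 * m ^ 2 - 6 * n) := by
  rw [shotMean_const_mul, shotMean_sum, ← sum_trace_four hρ h, mul_left_comm]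
  refine congrArg (24 * ·) ?_
  rw [Finset.mul_sum]
  refine Finset.sum_congr rfl fun I hI => ?_
  rw [shotMean_zString hE hρ, (Finset.mem_powersetCard.mp hI).2]

theorem fidelityAt_mul_le {n : ℕ} {E : SuperOp n} (hE : IsCPTP E) (k : ℕ) (a : ℝ) :
    fidelityAt E k * a ≤ |a| := by
  refine (le_abs_self _).trans ?_
  rw [abs_mul]
  exact mul_le_of_le_one_left (abs_nonneg a) (abs_fidelityAt_le hE k)

theorem secondMoment_symOp_one_le {n : ℕ} {E : SuperOp n} {ρ : Op n} {m : ℝ} (hE : IsCPTP E)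
    (hρ : IsState ρ) (h : magnetization n * ρ = (m : ℂ) • ρ) :
    shotMean E ρ (fun x => shotEst (symOp n 1) x ^ 2) ≤ m ^ 2 + 10 * n := by
  refine (shotMean_mono hE hρ sq_shotEst_symOp_one_le).trans ?_
  rw [shotMean_add, shotMean_const hE hρ, shotMean_symOp_two hE hρ h]
  have h1 := fidelityAt_mul_le hE 2 (m ^ 2 - n)
  have h2 : |m ^ 2 - (n : ℝ)| ≤ m ^ 2 + n := by
    have := Nat.cast_nonneg (α := ℝ) n
    rw [abs_le]
    constructor <;> nlinarith [sq_nonneg m]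
  linarith

theorem secondMoment_symOp_two_le {n : ℕ} {E : SuperOp n} {ρ : Op n} {m : ℝ} (hE : IsCPTP E)
    (hρ : IsState ρ) (h : magnetization n * ρ = (m : ℂ) • ρ) :
    shotMean E ρ (fun x => shotEst (symOp n 2) x ^ 2) ≤
      (m ^ 4 + 6 * m ^ 2 * n + 3 * n ^ 2 + 8 * m ^ 2 + 6 * n) +
        (36 * n * (m ^ 2 + 10 * n) + 486 * n) := by
  refine (shotMean_mono hE hρ sq_shotEst_symOp_two_le).trans ?_
  rw [shotMean_add, shotMean_add, shotMean_const_mul E ρ (36 * n), shotMean_const hE hρ,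
    shotMean_sum_four hE hρ h]
  have hn := Nat.cast_nonneg (α := ℝ) n
  have h0 := mul_nonneg (sq_nonneg m) hn
  gcongr ?_ + (36 * _ * ?_ + _)
  · refine (fidelityAt_mul_le hE 4 _).trans ?_
    rw [abs_le]
    constructor <;> nlinarith [sq_nonneg m, sq_nonneg (m ^ 2)]
  · exact secondMoment_symOp_one_le hE hρ h

theorem abs_shotEst_pauliString_le {n : ℕ} (p : Fin n → Fin 4) (x : SymCl n × Bits n) :
    |shotEst (pauliString p) x| ≤ 3 ^ weight p := by
  rw [shotEst_pauliString, abs_mul, abs_of_pos (by positivity)]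
  refine mul_le_of_le_one_right (by positivity) ?_
  rcases conjBy_pauliString_cases x.1 p with ⟨-, s, hs, h⟩ | ⟨-, h⟩
  · refine (Complex.abs_re_le_norm _).trans ?_
    have hs' : ‖s‖ = 1 := by
      have := congrArg norm hs
      rw [norm_mul, norm_one] at this
      nlinarith [norm_nonneg s]
    rw [h, Matrix.smul_apply, norm_smul, hs', one_mul, zString_eq_diagonal,
      Matrix.diagonal_apply_eq, Complex.norm_real, Real.norm_eq_abs, Finset.abs_prod]
    simp [abs_zVal]
  · simp [h]

/-! ### Concentration of sample means -/

theorem sum_prod_fin {α : Type*} [Fintype α] (T : ℕ) (w : α → ℝ) :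
    ∑ ω : Fin T → α, ∏ l, w (ω l) = (∑ a, w a) ^ T := by
  classical
  rw [← Fintype.sum_pow]

open scoped Classical in
theorem one_sided_tail {α : Type*} [Fintype α] {w g : α → ℝ} {R V t : ℝ} (T : ℕ)
    (hw : ∀ a, 0 ≤ w a) (hw1 : ∑ a, w a = 1) (hg0 : ∑ a, w a * g a = 0) (hg : ∀ a, |g a| ≤ R)
    (hV : ∑ a, w a * g a ^ 2 ≤ V) (hV0 : 0 < V) (ht : 0 < t) (htR : t * R ≤ 2 * V) :
    ∑ ω : Fin T → α, (if T * t ≤ ∑ l, g (ω l) then ∏ l, w (ω l) else 0) ≤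
      Real.exp (-(T * t ^ 2 / (4 * V))) := by
  -- This exponent minimizes c²V - ct, with minimum -t²/(4V).
  set c : ℝ := t / (2 * V) with hc
  have hc0 : 0 < c := by positivity
  have hle : ∑ a, w a * Real.exp (c * g a) ≤ 1 + c ^ 2 * V := by
    have hpt : ∀ a, w a * Real.exp (c * g a) ≤
        w a + c * (w a * g a) + c ^ 2 * (w a * g a ^ 2) := by
      intro a
      have h1 : |c * g a| ≤ 1 := by
        rw [abs_mul, abs_of_pos hc0]
        calc c * |g a| ≤ c * R := by gcongr; exact hg a
          _ = t * R / (2 * V) := by rw [hc]; ring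
          _ ≤ 1 := by rw [div_le_one (by positivity)]; exact htR
      have h2 := (abs_le.mp (Real.abs_exp_sub_one_sub_id_le h1)).2
      have h3 : Real.exp (c * g a) ≤ 1 + c * g a + c ^ 2 * g a ^ 2 := by nlinarith
      calc _ ≤ w a * (1 + c * g a + c ^ 2 * g a ^ 2) := mul_le_mul_of_nonneg_left h3 (hw a)
        _ = _ := by ring
    refine (Finset.sum_le_sum fun a _ => hpt a).trans ?_
    rw [Finset.sum_add_distrib, Finset.sum_add_distrib, ← Finset.mul_sum, ← Finset.mul_sum, hw1,
      hg0]
    nlinarith [sq_nonneg c]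
  have hexp : ∑ a, w a * Real.exp (c * g a - c * t) ≤ Real.exp (-(t ^ 2 / (4 * V))) := by
    simp only [sub_eq_add_neg, Real.exp_add, ← mul_assoc]
    rw [← Finset.sum_mul]
    calc _ ≤ Real.exp (c ^ 2 * V) * Real.exp (-(c * t)) := by
          gcongr
          refine hle.trans ?_
          rw [add_comm]
          exact Real.add_one_le_exp _
      _ = Real.exp (-(t ^ 2 / (4 * V))) := by
          rw [← Real.exp_add]
          congr 1
          rw [hc]
          field_simp
          ring
  have hbound : ∀ ω : Fin T → α, (if T * t ≤ ∑ l, g (ω l) then ∏ l, w (ω l) else 0) ≤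
      ∏ l, (w (ω l) * Real.exp (c * g (ω l) - c * t)) := by
    intro ω
    rw [Finset.prod_mul_distrib, ← Real.exp_sum]
    have hp : 0 ≤ ∏ l, w (ω l) := Finset.prod_nonneg fun l _ => hw _
    split_ifs with h
    · refine le_mul_of_one_le_right hp (Real.one_le_exp ?_)
      rw [Finset.sum_sub_distrib, ← Finset.mul_sum, Finset.sum_const, Finset.card_univ,
        Fintype.card_fin, nsmul_eq_mul]
      nlinarith
    · positivity
  refine (Finset.sum_le_sum fun ω _ => hbound ω).trans ?_
  rw [sum_prod_fin T fun a => w a * Real.exp (c * g a - c * t)]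
  refine (pow_le_pow_left₀ (Finset.sum_nonneg fun a _ =>
    mul_nonneg (hw a) (Real.exp_pos _).le) hexp T).trans_eq ?_
  rw [← Real.exp_nat_mul]
  congr 1
  ring

/-- A Bernstein-type bound for the mean of `T` independent runs. -/
theorem prob_deviation_le {n : ℕ} {E : SuperOp n} {ρ : Op n} (hE : IsCPTP E) (hρ : IsState ρ)
    {f : SymCl n × Bits n → ℝ} {V t : ℝ} {T : ℕ} (hT : 0 < T) (hf : ∀ x, |f x| ≤ V)
    (hV : shotVar E ρ f ≤ V) (hV0 : 0 < V) (ht : 0 < t) (ht1 : t ≤ 1) :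
    prob E ρ {ω : Fin T → SymCl n × Bits n |
      t ≤ |(T : ℝ)⁻¹ * ∑ l, f (ω l) - shotMean E ρ f|} ≤
        2 * Real.exp (-(T * t ^ 2 / (4 * V))) := by
  classical
  set μ := shotMean E ρ f with hμ
  have hw := shotProb_nonneg hE hρ
  have hw1 := sum_shotProb hE hρ
  have hμV : |μ| ≤ V := by
    rw [abs_le]
    constructor
    · rw [← shotMean_const hE hρ (-V)]
      exact shotMean_mono hE hρ fun x => (abs_le.mp (hf x)).1
    · rw [← shotMean_const hE hρ V]
      exact shotMean_mono hE hρ fun x => (abs_le.mp (hf x)).2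
  have hzero : ∑ x, shotProb E ρ x * (f x - μ) = 0 := by
    simp only [mul_sub, Finset.sum_sub_distrib]
    rw [← Finset.sum_mul, hw1, one_mul, hμ, shotMean, sub_self]
  have hdev : ∀ x, |f x - μ| ≤ 2 * V := fun x => by
    have := abs_sub (f x) μ
    linarith [hf x]
  -- The centred variable has range 2V, so the smallness condition of the tail bound is just t ≤ 1.
  have htR : t * (2 * V) ≤ 2 * V := mul_le_of_le_one_left (by linarith) ht1
  have h1 := one_sided_tail (g := fun x => f x - μ) T hw hw1 hzero hdev hV hV0 ht htR
  have h2 := one_sided_tail (g := fun x => -(f x - μ)) T hw hw1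
    (by simp only [mul_neg, Finset.sum_neg_distrib, hzero, neg_zero])
    (by simpa only [abs_neg] using hdev) (by simp only [neg_sq]; exact hV) hV0 ht htR
  have hT' : (0 : ℝ) < T := by exact_mod_cast hT
  calc _ ≤ ∑ ω : Fin T → SymCl n × Bits n,
        ((if T * t ≤ ∑ l, (f (ω l) - μ) then ∏ l, shotProb E ρ (ω l) else 0) +
          if T * t ≤ ∑ l, -(f (ω l) - μ) then ∏ l, shotProb E ρ (ω l) else 0) := by
        rw [prob]
        refine Finset.sum_le_sum fun ω _ => ?_
        have hp : 0 ≤ ∏ l, shotProb E ρ (ω l) := Finset.prod_nonneg fun l _ => hw _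
        by_cases hω : t ≤ |(T : ℝ)⁻¹ * ∑ l, f (ω l) - μ|
        · have hS : ∑ l, (f (ω l) - μ) = T * ((T : ℝ)⁻¹ * ∑ l, f (ω l) - μ) := by
            rw [Finset.sum_sub_distrib, Finset.sum_const, Finset.card_univ, Fintype.card_fin,
              nsmul_eq_mul]
            field_simp
          rw [Finset.sum_neg_distrib, hS, if_pos (show ω ∈ {ω : Fin T → SymCl n × Bits n |
            t ≤ |(T : ℝ)⁻¹ * ∑ l, f (ω l) - μ|} from hω)]
          rcases le_abs.mp hω with h | h
          · rw [if_pos (mul_le_mul_of_nonneg_left h hT'.le)]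
            split_ifs <;> linarith
          · rw [if_pos (c := _ ≤ -_) (by nlinarith)]
            split_ifs <;> linarith
        · rw [if_neg (show ω ∉ {ω : Fin T → SymCl n × Bits n |
            t ≤ |(T : ℝ)⁻¹ * ∑ l, f (ω l) - μ|} from hω)]
          split_ifs <;> linarith
    _ ≤ _ := by
        rw [Finset.sum_add_distrib]
        exact (add_le_add h1 h2).trans_eq (two_mul _).symm

theorem one_sub_le_prob {n : ℕ} {E : SuperOp n} {ρ : Op n} (hE : IsCPTP E) (hρ : IsState ρ)
    {ι : Type*} {T : ℕ} (s : Finset ι) (bad : ι → Set (Fin T → SymCl n × Bits n))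
    (good : Set (Fin T → SymCl n × Bits n)) (h : ∀ ω, (∀ i ∈ s, ω ∉ bad i) → ω ∈ good) :
    1 - ∑ i ∈ s, prob E ρ (bad i) ≤ prob E ρ good := by
  classical
  rw [sub_le_iff_le_add]
  have hone : ∑ ω : Fin T → SymCl n × Bits n, ∏ l, shotProb E ρ (ω l) = 1 := by
    rw [sum_prod_fin, sum_shotProb hE hρ, one_pow]
  rw [← hone]
  simp only [prob]
  rw [Finset.sum_comm, ← Finset.sum_add_distrib]
  refine Finset.sum_le_sum fun ω _ => ?_
  have hp : 0 ≤ ∏ l, shotProb E ρ (ω l) :=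
    Finset.prod_nonneg fun l _ => shotProb_nonneg hE hρ _
  have hterm : ∀ i ∈ s, 0 ≤ if ω ∈ bad i then ∏ l, shotProb E ρ (ω l) else 0 := fun i _ => by
    split_ifs <;> simp [hp]
  by_cases hg : ∀ i ∈ s, ω ∉ bad i
  · rw [if_pos (h ω hg)]
    exact le_add_of_nonneg_right (Finset.sum_nonneg hterm)
  · push Not at hg
    obtain ⟨i, hi, hbad⟩ := hg
    have h1 := Finset.single_le_sum hterm hi
    rw [if_pos hbad] at h1
    have h2 : 0 ≤ if ω ∈ good then ∏ l, shotProb E ρ (ω l) else 0 := by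
      split_ifs <;> simp [hp]
    linarith

theorem card_weight_one_or_two_le (n : ℕ) :
    (Finset.univ.filter fun p : Fin n → Fin 4 => weight p = 1 ∨ weight p = 2).card ≤
      16 * n ^ 2 := by
  classical
  -- Overwriting the zero string at two sites gives at most (4n)² strings; weight one uses the same
  -- site twice.
  let build : (Fin n × Fin 4) × (Fin n × Fin 4) → Fin n → Fin 4 := fun c =>
    Function.update (Function.update (fun _ => 0) c.1.1 c.1.2) c.2.1 c.2.2
  have hsub : (Finset.univ.filter fun p : Fin n → Fin 4 => weight p = 1 ∨ weight p = 2) ⊆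
      Finset.univ.image build := by
    intro p hp
    obtain ⟨i, j, hij⟩ : ∃ i j, ∀ k, p k ≠ 0 → k = i ∨ k = j := by
      rcases (Finset.mem_filter.mp hp).2 with h | h
      · obtain ⟨i, hi⟩ := Finset.card_eq_one.mp h
        refine ⟨i, i, fun k hk => ?_⟩
        have : k ∈ Finset.univ.filter fun i => p i ≠ 0 := by simp [hk]
        rw [hi] at this
        simpa using this
      · obtain ⟨i, j, -, hi⟩ := Finset.card_eq_two.mp h
        refine ⟨i, j, fun k hk => ?_⟩
        have : k ∈ Finset.univ.filter fun i => p i ≠ 0 := by simp [hk]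
        rw [hi] at this
        simpa using this
    refine Finset.mem_image.mpr ⟨((i, p i), (j, p j)), Finset.mem_univ _, ?_⟩
    funext k
    simp only [build, Function.update_apply]
    split_ifs with h1 h2
    · rw [h1]
    · rw [h2]
    · by_contra hk
      rcases hij k (Ne.symm hk) with h | h
      · exact h2 h
      · exact h1 h
  refine (Finset.card_le_card hsub).trans (Finset.card_image_le.trans ?_)
  simp only [Finset.card_univ, Fintype.card_prod, Fintype.card_fin]
  exact le_of_eq (by ring)

/-! ### Error mitigation -/

/-- Dividing two estimates damped by the same factor cancels the damping. -/
theorem abs_ratio_sub_le {N D F o ε : ℝ} (hF : 0 < F) (hε : 0 < ε) (hε1 : ε < 1) (ho : |o| ≤ 1)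
    (hN : |N - F * o| < ε * F / 4) (hD : |D - F| < ε * F / 4) : D ≠ 0 ∧ |N / D - o| ≤ ε := by
  have hD' := abs_lt.mp hD
  have hεF : ε * F < F := mul_lt_of_lt_one_left hF hε1
  have hDpos : F / 2 < D := by linarith
  have hD0 : 0 < D := by linarith
  refine ⟨hD0.ne', ?_⟩
  -- The numerator is below εF/2 and D > F/2, so the quotient is at most ε without a second-order
  -- term.
  rw [show N / D - o = ((N - F * o) - o * (D - F)) / D by field_simp; ring, abs_div,
    abs_of_pos hD0, div_le_iff₀ hD0]
  have h1 : |o * (D - F)| ≤ |D - F| := by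
    rw [abs_mul]
    exact mul_le_of_le_one_left (abs_nonneg _) ho
  have h2 := abs_sub (N - F * o) (o * (D - F))
  nlinarith

/-- If n ≤ 2B², use |m² - n| ≥ 1; otherwise |m² - n| ≥ n - B² ≥ n/2. -/
theorem abs_symVal_two_ge {n : ℕ} {B m : ℝ} (hmB : |m| ≤ B) (hm : 1 ≤ |m ^ 2 - n|) :
    (n : ℝ) ≤ (2 + 2 * B ^ 2) * |m ^ 2 - n| := by
  have hB : m ^ 2 ≤ B ^ 2 := sq_le_sq' (abs_le.mp hmB).1 (abs_le.mp hmB).2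
  have h1 := neg_abs_le (m ^ 2 - (n : ℝ))
  by_cases h : (n : ℝ) ≤ 2 * B ^ 2
  · nlinarith [sq_nonneg B]
  · nlinarith [sq_nonneg B]

theorem one_le_abs_of_int {a : ℝ} (h : ∃ k : ℤ, a = k) (ha : a ≠ 0) : 1 ≤ |a| := by
  obtain ⟨k, rfl⟩ := h
  exact_mod_cast Int.one_le_abs (by exact_mod_cast ha)

/-- The constant governing ranges and variances of all estimators. -/
noncomputable def varConst (B : ℝ) : ℝ := (2 + 2 * B ^ 2) ^ 2 * (B ^ 4 + 50 * B ^ 2 + 855)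

theorem varConst_ge (B : ℝ) : B ^ 2 + 10 ≤ varConst B ∧ 81 ≤ varConst B ∧
    9 * (2 + 2 * B ^ 2) ≤ varConst B := by
  have h0 : 0 ≤ B ^ 2 := sq_nonneg B
  have h1 : (1 : ℝ) ≤ 2 + 2 * B ^ 2 := by linarith
  have h2 : 9 * B ^ 2 + 855 ≤ B ^ 4 + 50 * B ^ 2 + 855 := by nlinarith [sq_nonneg (B ^ 2)]
  have h3 : B ^ 4 + 50 * B ^ 2 + 855 ≤ varConst B := by
    refine le_mul_of_one_le_left (by positivity) ?_
    exact one_le_pow₀ h1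
  refine ⟨by nlinarith, by nlinarith, ?_⟩
  nlinarith

/-! ### Variance and range of the normalized estimators -/

section Normalized

variable {n : ℕ} {ρ : Op n} {m B : ℝ} {E : SuperOp n}

theorem secondMoment_div (f : SymCl n × Bits n → ℝ) (s : ℝ) :
    shotMean E ρ (fun x => (f x / s) ^ 2) = (s ^ 2)⁻¹ * shotMean E ρ fun x => f x ^ 2 := by
  rw [← shotMean_const_mul]
  exact congrArg _ (funext fun x => by rw [div_pow]; ring)

theorem shotMean_div (f : SymCl n × Bits n → ℝ) (s : ℝ) :
    shotMean E ρ (fun x => f x / s) = shotMean E ρ f / s := by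
  rw [div_eq_inv_mul, ← shotMean_const_mul]
  exact congrArg _ (funext fun x => by rw [div_eq_inv_mul])

theorem shotVar_one_le (hE : IsCPTP E) (hρ : IsState ρ) (h : magnetization n * ρ = (m : ℂ) • ρ)
    (hn : 1 ≤ n) (hm : 1 ≤ |m|) (hmB : |m| ≤ B) :
    shotVar E ρ (fun x => shotEst (symOp n 1) x / m) ≤ varConst B * n := by
  have hn' : (1 : ℝ) ≤ n := by exact_mod_cast hn
  have hB : m ^ 2 ≤ B ^ 2 := sq_le_sq' (abs_le.mp hmB).1 (abs_le.mp hmB).2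
  have hm2 : 1 ≤ m ^ 2 := by rw [← sq_abs]; exact one_le_pow₀ hm
  calc _ ≤ _ := shotVar_le hE hρ _
    _ = (m ^ 2)⁻¹ * _ := secondMoment_div _ _
    _ ≤ 1 * (m ^ 2 + 10 * n) := by
        refine mul_le_mul (inv_le_one_of_one_le₀ hm2) (secondMoment_symOp_one_le hE hρ h)
          ?_ zero_le_one
        rw [← shotMean_const hE hρ 0]
        exact shotMean_mono hE hρ fun x => sq_nonneg _
    _ ≤ (B ^ 2 + 10) * n := by nlinarith [sq_nonneg B]
    _ ≤ varConst B * n := by gcongr; exact (varConst_ge B).1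

theorem shotVar_two_le (hE : IsCPTP E) (hρ : IsState ρ) (h : magnetization n * ρ = (m : ℂ) • ρ)
    (hn : 1 ≤ n) (hm : 1 ≤ |m ^ 2 - n|) (hmB : |m| ≤ B) :
    shotVar E ρ (fun x => shotEst (symOp n 2) x / (m ^ 2 - n)) ≤ varConst B := by
  have hn' : (1 : ℝ) ≤ n := by exact_mod_cast hn
  have hB : m ^ 2 ≤ B ^ 2 := sq_le_sq' (abs_le.mp hmB).1 (abs_le.mp hmB).2
  have hB4 : m ^ 4 ≤ B ^ 4 := by
    have := pow_le_pow_left₀ (sq_nonneg m) hB 2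
    nlinarith
  have hs : 0 < (m ^ 2 - (n : ℝ)) ^ 2 := by rw [← sq_abs]; positivity
  have hge := abs_symVal_two_ge hmB hm
  have hn2 : (n : ℝ) ^ 2 ≤ (2 + 2 * B ^ 2) ^ 2 * (m ^ 2 - n) ^ 2 := by
    rw [← sq_abs (m ^ 2 - (n : ℝ)), ← mul_pow]
    exact pow_le_pow_left₀ (by positivity) hge 2
  have hnn : (n : ℝ) ≤ n ^ 2 := by nlinarith
  calc _ ≤ _ := shotVar_le hE hρ _
    _ = ((m ^ 2 - (n : ℝ)) ^ 2)⁻¹ * _ := secondMoment_div _ _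
    -- Collecting the second moment gives 50 = 6 + 8 + 36 and 855 = 3 + 6 + 360 + 486, every
    -- monomial being absorbed into n².
    _ ≤ ((m ^ 2 - (n : ℝ)) ^ 2)⁻¹ * ((B ^ 4 + 50 * B ^ 2 + 855) * n ^ 2) := by
        gcongr
        refine (secondMoment_symOp_two_le hE hρ h).trans ?_
        have h1 : m ^ 4 ≤ B ^ 4 * n ^ 2 :=
          hB4.trans (le_mul_of_one_le_right (by positivity) (by nlinarith))
        have h2 : m ^ 2 * n ≤ B ^ 2 * n ^ 2 := by
          gcongr
        have h3 : m ^ 2 ≤ B ^ 2 * n ^ 2 :=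
          hB.trans (le_mul_of_one_le_right (by positivity) (by nlinarith))
        linarith
    _ ≤ ((m ^ 2 - (n : ℝ)) ^ 2)⁻¹ * ((B ^ 4 + 50 * B ^ 2 + 855) *
          ((2 + 2 * B ^ 2) ^ 2 * (m ^ 2 - n) ^ 2)) := by gcongr
    _ = varConst B := by
        have hs0 : m ^ 2 - (n : ℝ) ≠ 0 := pow_ne_zero_iff two_ne_zero |>.mp hs.ne'
        rw [varConst]
        field_simp

theorem abs_one_div_le (hn : 1 ≤ n) (hm : 1 ≤ |m|) (x : SymCl n × Bits n) :
    |shotEst (symOp n 1) x / m| ≤ varConst B * n := by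
  rw [abs_div]
  calc _ ≤ |shotEst (symOp n 1) x| := div_le_self (abs_nonneg _) hm
    _ ≤ 3 * n := abs_shotEst_symOp_one_le x
    _ ≤ varConst B * n := by
        gcongr
        linarith [(varConst_ge B).2.1]

theorem abs_two_div_le (hn : 1 ≤ n) (hm : 1 ≤ |m ^ 2 - n|) (hmB : |m| ≤ B)
    (x : SymCl n × Bits n) : |shotEst (symOp n 2) x / (m ^ 2 - n)| ≤ varConst B * n := by
  have hge := abs_symVal_two_ge hmB hm
  rw [abs_div, div_le_iff₀ (by linarith)]
  calc _ ≤ 9 * (n : ℝ) ^ 2 := abs_shotEst_symOp_two_le hn x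
    _ = 9 * n * n := by ring
    _ ≤ 9 * n * ((2 + 2 * B ^ 2) * |m ^ 2 - n|) := by gcongr
    _ = (9 * (2 + 2 * B ^ 2)) * n * |m ^ 2 - n| := by ring
    _ ≤ varConst B * n * |m ^ 2 - n| := by
        gcongr
        exact (varConst_ge B).2.2

theorem abs_pauliString_le_varConst (hn : 1 ≤ n) {p : Fin n → Fin 4}
    (hp : weight p = 1 ∨ weight p = 2) (x : SymCl n × Bits n) :
    |shotEst (pauliString p) x| ≤ varConst B * n ∧
      shotEst (pauliString p) x ^ 2 ≤ varConst B * n := by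
  have hn' : (1 : ℝ) ≤ n := by exact_mod_cast hn
  have h81 := (varConst_ge B).2.1
  have h9 : |shotEst (pauliString p) x| ≤ 9 := by
    refine (abs_shotEst_pauliString_le p x).trans ?_
    rcases hp with h | h <;> rw [h] <;> norm_num
  have hA : 81 ≤ varConst B * n := by nlinarith
  refine ⟨by linarith, ?_⟩
  rw [← sq_abs]
  nlinarith [abs_nonneg (shotEst (pauliString p) x)]

theorem shotVar_pauliString_le (hE : IsCPTP E) (hρ : IsState ρ) (hn : 1 ≤ n)
    {p : Fin n → Fin 4} (hp : weight p = 1 ∨ weight p = 2) :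
    shotVar E ρ (shotEst (pauliString p)) ≤ varConst B * n :=
  (shotVar_le hE hρ _).trans ((shotMean_mono hE hρ fun x =>
    (abs_pauliString_le_varConst hn hp x).2).trans_eq (shotMean_const hE hρ _))

end Normalized

/-! ### Sample complexity and the union bound -/

theorem union_bound_arith {n : ℕ} {δ x : ℝ} (hn : 2 ≤ n) (hδ : 0 < δ) (hδ1 : δ < 1)
    (hx : 8 * Real.log (n / δ) ≤ x) {N : ℕ} (hN : N ≤ 16 * n ^ 2 + 2) :
    N * (2 * Real.exp (-x)) ≤ δ := by
  have hn' : (2 : ℝ) ≤ n := by exact_mod_cast hn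
  have hn0 : (0 : ℝ) < n := by linarith
  have hexp : Real.exp (-x) ≤ (δ / n) ^ 8 := by
    have h1 : (δ / n) ^ 8 = Real.exp (-(8 * Real.log (n / δ))) := by
      have h2 := Real.exp_nat_mul (Real.log (δ / n)) 8
      rw [Real.exp_log (by positivity), Nat.cast_ofNat] at h2
      rw [← mul_neg, ← Real.log_inv, inv_div, h2]
    rw [h1]
    exact Real.exp_le_exp.mpr (by linarith)
  have hN' : (N : ℝ) ≤ 16 * n ^ 2 + 2 := by exact_mod_cast hN
  have h6 : (64 : ℝ) ≤ n ^ 6 := by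
    calc (64 : ℝ) = 2 ^ 6 := by norm_num
      _ ≤ n ^ 6 := by gcongr
  -- The eighth power is ample: n ≥ 2 gives n⁸ ≥ 64n², which absorbs the doubled number of events.
  have h8 : (32 * (n : ℝ) ^ 2 + 4) ≤ n ^ 8 := by
    have : (n : ℝ) ^ 8 = n ^ 6 * n ^ 2 := by ring
    nlinarith [sq_nonneg (n : ℝ)]
  have hδ8 : δ ^ 8 ≤ δ := pow_le_of_le_one hδ.le hδ1.le (by norm_num)
  calc N * (2 * Real.exp (-x)) ≤ (16 * n ^ 2 + 2) * (2 * (δ / n) ^ 8) := by gcongr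
    _ = (32 * n ^ 2 + 4) * (δ ^ 8 / n ^ 8) := by rw [div_pow]; ring
    _ ≤ n ^ 8 * (δ ^ 8 / n ^ 8) := by gcongr
    _ = δ ^ 8 := by field_simp
    _ ≤ δ := hδ8

theorem meanEst_div {n T : ℕ} (O : Op n) (s : ℝ) (ω : Fin T → SymCl n × Bits n) :
    (T : ℝ)⁻¹ * ∑ l, shotEst O (ω l) / s = meanEst O ω / s := by
  rw [meanEst, ← Finset.sum_div, mul_div_assoc]

theorem one_sub_le_prob_mitigated {n : ℕ} {ρ : Op n} {m B : ℝ} {E : SuperOp n} (hn : 2 ≤ n)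
    (hρ : IsState ρ) (h : magnetization n * ρ = (m : ℂ) • ρ) (hm1 : 1 ≤ |m|)
    (hm2 : 1 ≤ |m ^ 2 - n|) (hmB : |m| ≤ B) (hE : IsCPTP E) (hF : 0 < fidelity E) {ε δ : ℝ}
    (hε : 0 < ε) (hε1 : ε < 1) (hδ : 0 < δ) (hδ1 : δ < 1) {T : ℕ}
    (hT : 512 * varConst B * n * Real.log (n / δ) * (ε ^ 2)⁻¹ * (fidelity E ^ 2)⁻¹ ≤ T) :
    1 - δ ≤ prob E ρ {ω : Fin T → SymCl n × Bits n |
      meanEst (symOp n 1) ω ≠ 0 ∧ meanEst (symOp n 2) ω ≠ 0 ∧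
      ∀ p : Fin n → Fin 4, weight p = 1 ∨ weight p = 2 →
        |mitigatedEst m (pauliString p) (weight p) ω - (pauliString p * ρ).trace.re| ≤ ε} := by
  set F := fidelity E with hFdef
  have hn1 : 1 ≤ n := by omega
  have hn' : (2 : ℝ) ≤ n := by exact_mod_cast hn
  have hA := (varConst_ge B).2.1
  have hV0 : 0 < varConst B * n := by positivity
  have hF1 : F ≤ fidelityAt E 1 := min_le_left _ _
  have hF2 : F ≤ fidelityAt E 2 := min_le_right _ _
  have hFle : F ≤ 1 := hF1.trans ((le_abs_self _).trans (abs_fidelityAt_le hE 1))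
  have hlog : 0 < Real.log (n / δ) := Real.log_pos (by rw [lt_div_iff₀ hδ]; linarith)
  have hT0 : 0 < T := by
    have : (0 : ℝ) < T := lt_of_lt_of_le (by positivity) hT
    exact_mod_cast this
  set t := ε * F / 4 with ht
  have ht0 : 0 < t := by positivity
  have ht1 : t ≤ 1 := by nlinarith
  -- With t = εF/4 the Bernstein exponent is Tε²F²/(64V) for V = `varConst B * n`; asking for 8
  -- log(n/δ) yields the constant 512 = 64 · 8.
  have hx : 8 * Real.log (n / δ) ≤ T * t ^ 2 / (4 * (varConst B * n)) := by
    rw [le_div_iff₀ (by positivity), ht]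
    calc _ = (512 * varConst B * n * Real.log (n / δ) * (ε ^ 2)⁻¹ * (F ^ 2)⁻¹) *
          (ε * F / 4) ^ 2 := by field_simp; norm_num
      _ ≤ T * (ε * F / 4) ^ 2 := by gcongr
  set good : Finset (Fin n → Fin 4) :=
    Finset.univ.filter fun p => weight p = 1 ∨ weight p = 2 with hgood
  let f : Option (Option (Fin n → Fin 4)) → SymCl n × Bits n → ℝ := fun j =>
    match j with
    | none => fun x => shotEst (symOp n 1) x / m
    | some none => fun x => shotEst (symOp n 2) x / (m ^ 2 - n)
    | some (some p) => shotEst (pauliString p)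
  let bad : Option (Option (Fin n → Fin 4)) → Set (Fin T → SymCl n × Bits n) := fun j =>
    {ω | t ≤ |(T : ℝ)⁻¹ * ∑ l, f j (ω l) - shotMean E ρ (f j)|}
  have hbad : ∀ j ∈ Finset.insertNone (Finset.insertNone good), prob E ρ (bad j) ≤
      2 * Real.exp (-(T * t ^ 2 / (4 * (varConst B * n)))) := by
    intro j hj
    refine prob_deviation_le hE hρ hT0 ?_ ?_ hV0 ht0 ht1
    · match j with
      | none => exact abs_one_div_le hn1 hm1
      | some none => exact abs_two_div_le hn1 hm2 hmB
      | some (some p) =>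
        have hp : weight p = 1 ∨ weight p = 2 := by simpa [hgood] using hj
        exact fun x => (abs_pauliString_le_varConst hn1 hp x).1
    · match j with
      | none => exact shotVar_one_le hE hρ h hn1 hm1 hmB
      | some none =>
        refine (shotVar_two_le hE hρ h hn1 hm2 hmB).trans ?_
        exact le_mul_of_one_le_right (by linarith) (by linarith)
      | some (some p) =>
        have hp : weight p = 1 ∨ weight p = 2 := by simpa [hgood] using hj
        exact shotVar_pauliString_le hE hρ hn1 hp
  have hsum : ∑ j ∈ Finset.insertNone (Finset.insertNone good), prob E ρ (bad j) ≤ δ := by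
    refine (Finset.sum_le_sum hbad).trans ?_
    rw [Finset.sum_const, nsmul_eq_mul]
    refine union_bound_arith hn hδ hδ1 hx ?_
    rw [Finset.card_insertNone, Finset.card_insertNone]
    have : good.card ≤ 16 * n ^ 2 := card_weight_one_or_two_le n
    omega
  refine (by linarith : 1 - δ ≤ 1 - ∑ j ∈ Finset.insertNone (Finset.insertNone good),
    prob E ρ (bad j)).trans (one_sub_le_prob hE hρ _ bad _ fun ω hω => ?_)
  have hdev : ∀ j ∈ Finset.insertNone (Finset.insertNone good),
      |(T : ℝ)⁻¹ * ∑ l, f j (ω l) - shotMean E ρ (f j)| < t :=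
    fun j hj => not_le.mp (hω j hj)
  have hm0 : m ≠ 0 := by
    rintro rfl
    norm_num at hm1
  have hs0 : m ^ 2 - (n : ℝ) ≠ 0 := by
    intro h0
    rw [h0] at hm2
    norm_num at hm2
  have hD1 : |meanEst (symOp n 1) ω / m - fidelityAt E 1| < t := by
    have := hdev none (by simp)
    simp only [f] at this
    rwa [meanEst_div, shotMean_div, shotMean_symOp_one hE hρ h, mul_div_cancel_right₀ _ hm0]
      at this
  have hD2 : |meanEst (symOp n 2) ω / (m ^ 2 - n) - fidelityAt E 2| < t := by
    have := hdev (some none) (by simp)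
    simp only [f] at this
    rwa [meanEst_div, shotMean_div, shotMean_symOp_two hE hρ h, mul_div_cancel_right₀ _ hs0]
      at this
  have hP : ∀ p, weight p = 1 ∨ weight p = 2 → |meanEst (pauliString p) ω -
      fidelityAt E (weight p) * (pauliString p * ρ).trace.re| < t := by
    intro p hp
    have := hdev (some (some p)) (by simpa [hgood] using hp)
    change |meanEst (pauliString p) ω - shotMean E ρ (shotEst (pauliString p))| < t at this
    rwa [shotMean_pauliString hE hρ] at this
  have hstep : ∀ {N D Fk o : ℝ}, F ≤ Fk → |o| ≤ 1 → |N - Fk * o| < t → |D - Fk| < t →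
      D ≠ 0 ∧ |N / D - o| ≤ ε := by
    intro N D Fk o hFk ho h1 h2
    have htk : t ≤ ε * Fk / 4 := by rw [ht]; gcongr
    exact abs_ratio_sub_le (hF.trans_le hFk) hε hε1 ho (h1.trans_le htk) (h2.trans_le htk)
  -- A dummy numerator with o = 0, so that `hstep` also delivers the nonvanishing of the
  -- denominators.
  have hnum : ∀ Fk : ℝ, |Fk * 0 - Fk * 0| < t := fun Fk => by simpa using ht0
  refine ⟨?_, ?_, fun p hp => ?_⟩
  · have := (hstep hF1 (by norm_num) (hnum _) hD1).1
    exact fun h0 => this (by rw [h0, zero_div])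
  · have := (hstep hF2 (by norm_num) (hnum _) hD2).1
    exact fun h0 => this (by rw [h0, zero_div])
  · have hp' := hP p hp
    have ho := abs_trace_pauliString_le hρ p
    rw [mitigatedEst]
    rcases hp with hp | hp
    · rw [hp] at hp' ⊢
      exact (hstep hF1 ho hp' hD1).2
    · rw [hp] at hp' ⊢
      exact (hstep hF2 ho hp' hD2).2

theorem prob_mono {n : ℕ} {E : SuperOp n} {ρ : Op n} (hE : IsCPTP E) (hρ : IsState ρ) {T : ℕ}
    {s s' : Set (Fin T → SymCl n × Bits n)} (h : s ⊆ s') : prob E ρ s ≤ prob E ρ s' := by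
  refine Finset.sum_le_sum fun ω _ => ?_
  have hp : 0 ≤ ∏ l, shotProb E ρ (ω l) :=
    Finset.prod_nonneg fun l _ => shotProb_nonneg hE hρ _
  by_cases hω : ω ∈ s
  · rw [if_pos hω, if_pos (h hω)]
  · rw [if_neg hω]
    split_ifs <;> simp [hp]

end SymShadow

/-! ### The main theorem -/

open SymShadow in
theorem theorem2 :
    ∃ c : ℝ, 0 < c ∧ ∀ B : ℝ, 0 < B → ∃ K : ℝ, 0 < K ∧
      ∀ (n : ℕ) (ρ : Op n) (m : ℝ) (E : SuperOp n),
        2 ≤ n → IsState ρ → magnetization n * ρ = (m : ℂ) • ρ →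
        0 < |m| → |m| ≤ B → m ^ 2 ≠ n → IsCPTP E →
        -- the symmetry operators have the known ideal values `s₁ = m`, `s₂ = m² - n`
        ((symOp n 1 * ρ).trace = (symVal n m 1 : ℂ) ∧
          (symOp n 2 * ρ).trace = (symVal n m 2 : ℂ)) ∧
        -- variance bounds for the normalized symmetry estimators
        shotVar E ρ (fun x => shotEst (symOp n 1) x / symVal n m 1) ≤ K * n ∧
        shotVar E ρ (fun x => shotEst (symOp n 2) x / symVal n m 2) ≤ K ∧
        -- sample complexity, uniformly over all one- and two-local Pauli operators
        (0 < fidelity E →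
          ∀ (ε δ : ℝ), 0 < ε → ε < 1 → 0 < δ → δ < 1 →
            ∀ T : ℕ, K * n * Real.log (n / δ) * (ε ^ 2)⁻¹ * (fidelity E ^ 2)⁻¹ ≤ T →
              1 - δ ≤ prob E ρ {ω : Fin T → SymCl n × Bits n |
                meanEst (symOp n 1) ω ≠ 0 ∧ meanEst (symOp n 2) ω ≠ 0 ∧
                ∀ p : Fin n → Fin 4, weight p = 1 ∨ weight p = 2 →
                  |mitigatedEst m (pauliString p) (weight p) ω -
                    (pauliString p * ρ).trace.re| ≤ ε + c * ε ^ 2}) := by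
  -- The value c = 1 is arbitrary, since the error is already at most ε.
  refine ⟨1, one_pos, fun B _ => ⟨512 * varConst B, ?_, ?_⟩⟩
  · linarith [(varConst_ge B).2.1]
  intro n ρ m E hn hρ h hm0 hmB hmn hE
  have hA := (varConst_ge B).2.1
  have hn1 : 1 ≤ n := by omega
  have hint := exists_int_magnetization hρ h
  have hm1 : 1 ≤ |m| := one_le_abs_of_int hint (abs_pos.mp hm0)
  have hm2 : 1 ≤ |m ^ 2 - n| := by
    -- Integrality of m bounds the nonzero integer m² - n away from zero.
    refine one_le_abs_of_int ?_ (sub_ne_zero.mpr hmn)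
    obtain ⟨k, rfl⟩ := hint
    exact ⟨k ^ 2 - n, by push_cast; rfl⟩
  refine ⟨⟨trace_symOp_one hρ h, trace_symOp_two hρ h⟩, ?_, ?_, ?_⟩
  · refine (shotVar_one_le hE hρ h hn1 hm1 hmB).trans ?_
    gcongr
    linarith
  · refine (shotVar_two_le hE hρ h hn1 hm2 hmB).trans ?_
    linarith
  · intro hF ε δ hε hε1 hδ hδ1 T hT
    refine (one_sub_le_prob_mitigated hn hρ h hm1 hm2 hmB hE hF hε hε1 hδ hδ1 hT).trans
      (prob_mono hE hρ ?_)
    rintro ω ⟨h1, h2, h3⟩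
    exact ⟨h1, h2, fun p hp => (h3 p hp).trans (by nlinarith)⟩
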